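/- Let $0<\alpha<\pi$, $\mu>1$ and $\beta=\pi/(2\pi-\alpha)$. Let $D\subset\mathbb R^2$ be a bounded domain, symmetric with respect to the $x_1$-axis, which coincides in the disk $B_\mu$ of radius $\mu$ about the origin $\mathbf o$ with the cone $\{(x_1,x_2): |x_2|<-\tan(\alpha/2)\,x_1\}$, and whose boundary is smooth except at the vertex $\mathbf o$. For $\varepsilon>0$ let $V_1=(-\varepsilon/2,0)$ and let $\Omega_1=D+V_1$ be the translate of $D$ with vertex $V_1$. Let $u$ be the solution of $$\Delta u=\mathbf i\cdot\nabla\delta_{\mathbf o}\ \text{ in }\mathbb R^2\setminus\overline{\Omega_1},\qquad u=c_1\ \text{(an unprescribed constant) on }\partial\Omega_1,\qquad u(X)=O(|X|^{-1})\ \text{ as }|X|\to\infty,$$ where $\mathbf i=(1,0)$, the equation is understood in the sense of distributions, and $u$ is continuous on $\mathbb R^2\setminus(\Omega_1\cup\{\mathbf o\})$. Then there exist constants $\kappa_0\in(0,1/2)$, $\varepsilon_0>0$ and $c,C>0$, independent of $\varepsilon$, such that for all $0<\varepsilon\le\varepsilon_0$ and all $X\in B_{\kappa_0\varepsilon}(V_1)\setminus\overline{\Omega_1}$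 the function $u$ is differentiable at $X$ and $$c\,\varepsilon^{-1-\beta}|X-V_1|^{\beta-1}\le|\nabla u(X)|\le C\,\varepsilon^{-1-\beta}|X-V_1|^{\beta-1}.$$ -/

import Mathlib

open Set Metric Filter Asymptotics MeasureTheory
open scoped ContDiff Laplacian Pointwise

/-- The Euclidean plane. -/
abbrev Plane : Type := EuclideanSpace ℝ (Fin 2)

/-- The open cone with vertex at the origin and aperture angle `α`, lying in the left half-plane
and symmetric about the `x₁`-axis. -/
def leftCone (α : ℝ) : Set Plane :=
  {x | |x 1| < -(Real.tan (α / 2) * x 0)}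

/-- `D` has a smooth boundary near the point `p`: locally `D` is a sublevel set of a smooth
function whose differential does not vanish at `p`. -/
def SmoothBoundaryAt (D : Set Plane) (p : Plane) : Prop :=
  ∃ U : Set Plane, IsOpen U ∧ p ∈ U ∧ ∃ f : Plane → ℝ,
    ContDiff ℝ ∞ f ∧ fderiv ℝ f p ≠ 0 ∧ D ∩ U = {x | f x < 0} ∩ U

/-- The shape of an inclusion with one corner, placed so that its vertex is the origin: a bounded
domain, symmetric about the `x₁`-axis, which coincides with the cone of aperture `α` in the disk
of radius `μ` and has a smooth boundary away from the vertex. -/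
structure IsCornerShape (α μ : ℝ) (D : Set Plane) : Prop where
  isOpen : IsOpen D
  isConnected : IsConnected D
  isBounded : Bornology.IsBounded D
  symmetric : ∀ x : Plane, x ∈ D → !₂[x 0, -x 1] ∈ D
  eq_cone : D ∩ ball 0 μ = leftCone α ∩ ball 0 μ
  smooth : ∀ p ∈ frontier D, p ≠ 0 → SmoothBoundaryAt D p

/-- The vertex `V₁ = (-ε/2, 0)`. -/
noncomputable def vertex (ε : ℝ) : Plane := !₂[-ε / 2, 0]

/-- The inclusion `Ω₁`: the translate of the fixed shape `D` whose vertex is `(-ε/2, 0)`. -/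
noncomputable def cornerInclusion (D : Set Plane) (ε : ℝ) : Set Plane := vertex ε +ᵥ D

/-- `Δ u = a · ∇ δ_p` in the sense of distributions on the open set `U`. -/
def LaplaceEqDipole (u : Plane → ℝ) (U : Set Plane) (a p : Plane) : Prop :=
  LocallyIntegrableOn u U volume ∧
    ∀ ψ : Plane → ℝ, ContDiff ℝ ∞ ψ → HasCompactSupport ψ → tsupport ψ ⊆ U →
      ∫ x, u x * Δ ψ x = -(fderiv ℝ ψ p a)

/-- `u` is a solution of the problem with the perfectly conducting inclusion `Ω` and a dipole
emitter at the origin in the direction `(1, 0)`: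
`Δ u = (1, 0) · ∇ δ₀` outside the closure of `Ω`, `u` is equal to a constant on `∂Ω` (and attains
this boundary value continuously), and `u(X) = O(|X|⁻¹)` as `|X| → ∞`. -/
structure IsDipoleSolution (Ω : Set Plane) (u : Plane → ℝ) : Prop where
  equation : LaplaceEqDipole u (closure Ω)ᶜ !₂[1, 0] 0
  continuousOn : ContinuousOn u (Ωᶜ \ {0})
  boundary : ∃ c : ℝ, ∀ x ∈ frontier Ω, u x = c
  decay : u =O[Bornology.cobounded Plane] fun x => ‖x‖⁻¹

open InnerProductSpace Topology in
theorem HarmonicAt.exists_analyticAt_re {f : ℂ → ℝ} {z : ℂ} (hf : HarmonicAt f z) :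
    ∃ F : ℂ → ℂ, AnalyticAt ℂ F z ∧ f =ᶠ[𝓝 z] fun w => (F w).re := by
  obtain ⟨r, hr, hsub⟩ := Metric.eventually_nhds_iff_ball.1 hf.eventually
  obtain ⟨F, hF, he⟩ := HarmonicOnNhd.exists_analyticOnNhd_ball_re_eq (f := f) (z := z) (R := r) hsub
  exact ⟨F, hF z (mem_ball_self hr),
    Filter.eventually_of_mem (ball_mem_nhds z hr) fun w hw => (he hw).symm⟩

open InnerProductSpace Topology in
theorem HarmonicAt.comp_analyticAt {f : ℂ → ℝ} {g : ℂ → ℂ} {z : ℂ} (hf : HarmonicAt f (g z))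
    (hg : AnalyticAt ℂ g z) : HarmonicAt (fun w => f (g w)) z := by
  obtain ⟨F, hF, he⟩ := HarmonicAt.exists_analyticAt_re hf
  refine (harmonicAt_congr_nhds (he.comp_tendsto hg.continuousAt)).2 ?_
  exact (hF.comp hg).harmonicAt_re

open InnerProductSpace Topology in
/-- A harmonic function with a local maximum is locally constant. -/
theorem HarmonicAt.eventually_eq_of_isLocalMax {f : ℂ → ℝ} {z : ℂ} (hf : HarmonicAt f z)
    (hmax : IsLocalMax f z) : ∀ᶠ w in 𝓝 z, f w = f z := by
  obtain ⟨F, hF, he⟩ := HarmonicAt.exists_analyticAt_re hf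
  have h1 : IsLocalMax (norm ∘ fun w => Complex.exp (F w)) z := by
    filter_upwards [hmax, he] with w hw hw'
    simp only [Function.comp_apply, Complex.norm_exp]
    rw [← he.eq_of_nhds, ← hw']
    exact Real.exp_le_exp.2 hw
  have h2 : ∀ᶠ w in 𝓝 z, DifferentiableAt ℂ (fun w => Complex.exp (F w)) w := by
    filter_upwards [hF.eventually_analyticAt] with w hw using hw.differentiableAt.cexp
  filter_upwards [Complex.eventually_eq_of_isLocalMax_norm h2 h1, he] with w hw hw'
  have := congrArg norm hw
  simp only [Complex.norm_exp, Real.exp_eq_exp] at this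
  rw [hw', he.eq_of_nhds, this]

open InnerProductSpace Topology in
/-- The maximum principle for harmonic functions on a bounded open set. -/
theorem HarmonicOnNhd.le_of_forall_frontier_le {U : Set ℂ} (hUo : IsOpen U)
    (hUb : Bornology.IsBounded U) {f : ℂ → ℝ} (hf : HarmonicOnNhd f U)
    (hc : ContinuousOn f (closure U)) {m : ℝ} (hm : ∀ z ∈ frontier U, f z ≤ m) :
    ∀ z ∈ closure U, f z ≤ m := by
  by_contra! hcon
  obtain ⟨z₀, hz₀, hlt⟩ := hcon
  have hK : IsCompact (closure U) := hUb.isCompact_closure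
  obtain ⟨z₁, hz₁, hmax⟩ := hK.exists_isMaxOn ⟨z₀, hz₀⟩ hc
  have hA : IsCompact (closure U ∩ f ⁻¹' {f z₁}) :=
    hK.of_isClosed_subset (hc.preimage_isClosed_of_isClosed isClosed_closure isClosed_singleton)
      inter_subset_left
  obtain ⟨w, ⟨hw, hfw⟩, hwmax⟩ :=
    hA.exists_isMaxOn ⟨z₁, hz₁, rfl⟩ Complex.continuous_re.continuousOn
  have hfw : f w = f z₁ := hfw
  have hwU : w ∈ U := by
    by_contra hn
    have h1 : w ∈ frontier U := by rw [hUo.frontier_eq]; exact ⟨hw, hn⟩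
    have h2 := hm w h1
    have h3 : f z₀ ≤ f z₁ := hmax hz₀
    linarith
  have hloc : IsLocalMax f w := by
    filter_upwards [hUo.mem_nhds hwU] with y hy
    rw [hfw]
    exact hmax (subset_closure hy)
  have hev := (HarmonicAt.eventually_eq_of_isLocalMax (hf w hwU) hloc).and (hUo.mem_nhds hwU)
  obtain ⟨r, hr, hball⟩ := Metric.eventually_nhds_iff_ball.1 hev
  have hy := hball (w + (r / 2 : ℝ)) (by
    rw [mem_ball, dist_eq_norm, add_sub_cancel_left, Complex.norm_real, Real.norm_eq_abs,
      abs_of_pos (by positivity)]; linarith)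
  have := hwmax (a := w + (r / 2 : ℝ)) ⟨subset_closure hy.2, by
    simp only [mem_preimage, mem_singleton_iff]; rw [hy.1, hfw]⟩
  simp only [mem_ofPred_eq, Complex.add_re, Complex.ofReal_re] at this
  linarith

open InnerProductSpace Topology in
/-- The maximum principle for harmonic functions vanishing at infinity, in the exterior of an open
set of the plane. As `log` is unbounded at infinity, the value at infinity plays no role. -/
theorem HarmonicOnNhd.le_of_forall_frontier_le_exterior {D : Set ℂ} (hDo : IsOpen D)
    (hDn : D.Nonempty) {f : ℂ → ℝ} (hf : HarmonicOnNhd f (closure D)ᶜ)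
    (hc : ContinuousOn f Dᶜ) (hlim : Tendsto f (Bornology.cobounded ℂ) (𝓝 0)) {m : ℝ}
    (hm : ∀ z ∈ frontier D, f z ≤ m) : ∀ z ∈ Dᶜ, f z ≤ m := by
  obtain ⟨p, hp⟩ := hDn
  obtain ⟨r, hr, hball⟩ := Metric.isOpen_iff.1 hDo p hp
  have hfar : ∀ z ∈ Dᶜ, r ≤ ‖z - p‖ := by
    intro z hz
    by_contra! h
    exact hz (hball (by rwa [mem_ball, dist_eq_norm]))
  intro z hz
  have key : ∀ δ : ℝ, 0 < δ → f z ≤ m + δ * Real.log (‖z - p‖ / r) := by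
    intro δ hδ
    have hbd : ∀ᶠ w in Bornology.cobounded ℂ, f w ≤ 1 := by
      filter_upwards [hlim.eventually (gt_mem_nhds (zero_lt_one))] with w hw using hw.le
    obtain ⟨R₁, -, hR₁⟩ := (hasBasis_cobounded_norm).eventually_iff.1 hbd
    have hlog : ∀ᶠ ρ : ℝ in atTop, 1 - m ≤ δ * Real.log (ρ / r) :=
      ((Real.tendsto_log_atTop.comp (tendsto_id.atTop_div_const hr)).const_mul_atTop
        hδ).eventually_ge_atTop _
    obtain ⟨ρ, hρ1, hρ2, hρ3, hρ4⟩ := (hlog.and ((eventually_gt_atTop ‖z - p‖).and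
      ((eventually_ge_atTop (R₁ + ‖p‖)).and (eventually_gt_atTop 0)))).exists
    set U : Set ℂ := (closure D)ᶜ ∩ ball p ρ with hU
    have hUo : IsOpen U := isClosed_closure.isOpen_compl.inter isOpen_ball
    have hclD : closure U ⊆ Dᶜ := closure_minimal
      (fun w hw h => hw.1 (subset_closure h)) hDo.isClosed_compl
    have hclB : closure U ⊆ closedBall p ρ := closure_minimal
      (fun w hw => ball_subset_closedBall hw.2) isClosed_closedBall
    have hne : ∀ w ∈ Dᶜ, w - p ≠ 0 := fun w hw => norm_pos_iff.1 (hr.trans_le (hfar w hw))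
    have hharm : HarmonicOnNhd (f - δ • fun w => Real.log ‖w - p‖) U := by
      intro w hw
      refine (hf w hw.1).sub (HarmonicAt.const_smul ?_)
      exact AnalyticAt.harmonicAt_log_norm (f := fun w => w - p) (by fun_prop)
        (hne w (hclD (subset_closure hw)))
    have hcont : ContinuousOn (f - δ • fun w => Real.log ‖w - p‖) (closure U) := by
      refine (hc.mono hclD).sub (ContinuousOn.const_smul ?_ δ)
      refine ContinuousOn.log (by fun_prop) fun w hw => ?_
      exact norm_ne_zero_iff.2 (hne w (hclD hw))
    have hfront : ∀ w ∈ frontier U,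
        (f - δ • fun w => Real.log ‖w - p‖) w ≤ m - δ * Real.log r := by
      intro w hw
      rw [hUo.frontier_eq] at hw
      obtain ⟨hw1, hw2⟩ := hw
      have hwD := hclD hw1
      have hfw := hfar w hwD
      simp only [Pi.sub_apply, Pi.smul_apply, smul_eq_mul]
      by_cases hcl : w ∈ closure D
      · have h1 := hm w (by rw [hDo.frontier_eq]; exact ⟨hcl, hwD⟩)
        have h2 := mul_le_mul_of_nonneg_left (Real.log_le_log hr hfw) hδ.le
        linarith
      · have hnb : w ∉ ball p ρ := fun h => hw2 ⟨hcl, h⟩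
        have h3 : ‖w - p‖ = ρ := by
          have := hclB hw1
          rw [mem_closedBall, dist_eq_norm] at this
          rw [mem_ball, dist_eq_norm] at hnb
          linarith
        have h4 : f w ≤ 1 := hR₁ (by
          have := norm_sub_le w p
          simp only [mem_ofPred_eq]; linarith)
        rw [h3]
        rw [Real.log_div hρ4.ne' hr.ne'] at hρ1
        linarith
    have hzcl : z ∈ closure U ∨ z ∈ frontier D := by
      by_cases hcl : z ∈ closure D
      · right; rw [hDo.frontier_eq]; exact ⟨hcl, hz⟩
      · left; exact subset_closure ⟨hcl, by rwa [mem_ball, dist_eq_norm]⟩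
    rw [Real.log_div (norm_ne_zero_iff.2 (hne z hz)) hr.ne']
    rcases hzcl with h | h
    · have := HarmonicOnNhd.le_of_forall_frontier_le hUo
        (isBounded_ball.subset inter_subset_right) hharm hcont hfront z h
      simp only [Pi.sub_apply, Pi.smul_apply, smul_eq_mul] at this
      linarith
    · have h1 := hm z h
      have h2 := mul_le_mul_of_nonneg_left (Real.log_le_log hr (hfar z hz)) hδ.le
      linarith
  by_contra! hlt
  set l := Real.log (‖z - p‖ / r)
  have hl : 0 ≤ l := Real.log_nonneg ((one_le_div hr).2 (hfar z hz))
  have h1 := key ((f z - m) / (2 * (l + 1))) (div_pos (by linarith) (by linarith))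
  have h2 : (f z - m) / (2 * (l + 1)) * l < f z - m := by
    rw [div_mul_eq_mul_div, div_lt_iff₀ (by linarith)]
    nlinarith
  linarith

/-- Gradient estimate for harmonic functions, in terms of a holomorphic function whose real part is
the given harmonic function. -/
theorem norm_deriv_le_of_abs_re_le {F : ℂ → ℂ} {z : ℂ} {r m : ℝ} (hr : 0 < r) (hm : 0 < m)
    (hF : DifferentiableOn ℂ F (ball z r)) (hb : ∀ w ∈ ball z r, |(F w).re| ≤ m) :
    ‖deriv F z‖ ≤ 2 * Real.exp 2 * m / r := by
  set G : ℂ → ℂ := fun w => Complex.exp (F w / m) with hG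
  have hGd : DifferentiableOn ℂ G (ball z r) := (hF.div_const _).cexp
  have hre : ∀ w, (F w / m).re = (F w).re / m := fun w => Complex.div_ofReal_re _ _
  have hGn : ∀ w ∈ ball z r, ‖G w‖ ≤ Real.exp 1 := fun w hw => by
    rw [hG, Complex.norm_exp, hre]
    exact Real.exp_le_exp.2 ((div_le_one hm).2 (le_of_abs_le (hb w hw)))
  have hlow : Real.exp (-1) ≤ ‖G z‖ := by
    rw [hG, Complex.norm_exp, hre]
    refine Real.exp_le_exp.2 ?_
    rw [le_div_iff₀ hm]
    linarith [neg_le_of_abs_le (hb z (mem_ball_self hr))]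
  have hC : ‖deriv G z‖ ≤ Real.exp 1 / (r / 2) := by
    refine Complex.norm_deriv_le_of_forall_mem_sphere_norm_le (by positivity) ?_ ?_
    · refine (hGd.mono ?_).diffContOnCl
      rw [closure_ball z (by positivity)]
      exact closedBall_subset_ball (by linarith)
    · intro w hw
      refine hGn w ?_
      rw [mem_sphere] at hw
      rw [mem_ball]; linarith
  have hFz : DifferentiableAt ℂ F z := hF.differentiableAt (ball_mem_nhds z hr)
  have hd : deriv G z = G z * (deriv F z / m) := (hFz.hasDerivAt.div_const _).cexp.deriv
  rw [hd, norm_mul, norm_div, Complex.norm_real, Real.norm_eq_abs, abs_of_pos hm] at hC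
  have h1 : Real.exp (-1) * (‖deriv F z‖ / m) ≤ Real.exp 1 / (r / 2) :=
    (mul_le_mul_of_nonneg_right hlow (by positivity)).trans hC
  have h2 : Real.exp 2 = Real.exp 1 * Real.exp 1 := by rw [← Real.exp_add]; norm_num
  rw [Real.exp_neg] at h1
  have he := Real.exp_pos 1
  rw [h2]
  field_simp at h1 ⊢
  nlinarith

open InnerProductSpace Topology in
/-- The maximum principle in a half-disc whose diameter lies on the imaginary axis. -/
theorem HarmonicOnNhd.nonpos_of_halfDisc {c : ℂ} {s : ℝ} {g : ℂ → ℝ}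
    (hg : HarmonicOnNhd g {z | 0 < z.re ∧ z ∈ ball c s})
    (hc : ContinuousOn g {z | 0 ≤ z.re ∧ z ∈ closedBall c s})
    (h0 : ∀ z, z.re = 0 → z ∈ closedBall c s → g z ≤ 0)
    (h1 : ∀ z, 0 ≤ z.re → ‖z - c‖ = s → g z ≤ 0) :
    ∀ z, 0 ≤ z.re → z ∈ ball c s → g z ≤ 0 := by
  have hcl : closure {z | 0 < z.re ∧ z ∈ ball c s} ⊆ {z | 0 ≤ z.re ∧ z ∈ closedBall c s} := by
    refine closure_minimal (fun z hz => ⟨hz.1.le, ball_subset_closedBall hz.2⟩) ?_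
    exact (isClosed_le continuous_const Complex.continuous_re).inter isClosed_closedBall
  have hUo : IsOpen {z : ℂ | 0 < z.re ∧ z ∈ ball c s} :=
    (isOpen_lt continuous_const Complex.continuous_re).inter isOpen_ball
  intro z hz hzb
  rcases hz.eq_or_lt with h | h
  · exact h0 z h.symm (ball_subset_closedBall hzb)
  · refine HarmonicOnNhd.le_of_forall_frontier_le hUo (isBounded_ball.subset fun w hw => hw.2) hg
      (hc.mono hcl) ?_ z (subset_closure ⟨h, hzb⟩)
    intro w hw
    rw [hUo.frontier_eq] at hw
    obtain ⟨hw1, hw2⟩ := hcl hw.1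
    rcases hw1.eq_or_lt with h' | h'
    · exact h0 w h'.symm hw2
    · refine h1 w hw1 ?_
      have h3 : w ∉ ball c s := fun hb => hw.2 ⟨h', hb⟩
      rw [mem_ball, dist_eq_norm] at h3
      rw [mem_closedBall, dist_eq_norm] at hw2
      linarith

open InnerProductSpace Topology in
/-- Linear decay at the flat part of the boundary: comparison with the barrier `2 w - w ^ 2`. -/
theorem HarmonicOnNhd.le_mul_re_of_halfDisc {s M y : ℝ} (hs : 0 < s) (hM : 0 ≤ M) {v : ℂ → ℝ}
    (hv : HarmonicOnNhd v {z | 0 < z.re ∧ z ∈ ball (y * Complex.I) s})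
    (hc : ContinuousOn v {z | 0 ≤ z.re ∧ z ∈ closedBall (y * Complex.I) s})
    (h0 : ∀ z, z.re = 0 → z ∈ closedBall (y * Complex.I) s → v z = 0)
    (h1 : ∀ z, 0 ≤ z.re → ‖z - y * Complex.I‖ = s → v z ≤ M)
    {x : ℝ} (hx : 0 ≤ x) (hxs : x < s) : v (x + y * Complex.I) ≤ 2 * M * x / s := by
  set b : ℂ → ℂ := fun z => 2 * ((z - y * Complex.I) / s) - ((z - y * Complex.I) / s) ^ 2 with hb
  have hbre : ∀ z : ℂ, (b z).re = 2 * (z.re / s) - ((z.re / s) ^ 2 - ((z.im - y) / s) ^ 2) := by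
    intro z
    simp [hb, Complex.sub_re, Complex.sub_im, pow_two, Complex.mul_re, Complex.div_ofReal]
  have hban : ∀ z, AnalyticAt ℂ b z := fun z => by
    rw [hb]
    refine AnalyticAt.sub (analyticAt_const.mul ?_) (AnalyticAt.pow ?_ 2) <;>
    exact (by fun_prop : AnalyticAt ℂ (fun z : ℂ => z - y * Complex.I) z).div_const
  have hbc : Continuous fun z => (b z).re :=
    Complex.continuous_re.comp (continuous_iff_continuousAt.2 fun z => (hban z).continuousAt)
  have key := HarmonicOnNhd.nonpos_of_halfDisc (c := y * Complex.I) (s := s)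
    (g := v - M • fun z => (b z).re)
    (hv.sub fun z _ => HarmonicAt.const_smul (hban z).harmonicAt_re)
    (hc.sub (hbc.const_smul M).continuousOn)
    (fun z hz hz' => by
      simp only [Pi.sub_apply, Pi.smul_apply, smul_eq_mul, hbre, hz, h0 z hz hz']
      have : 0 ≤ M * ((z.im - y) / s) ^ 2 := by positivity
      simpa using this)
    (fun z hz hz' => by
      simp only [Pi.sub_apply, Pi.smul_apply, smul_eq_mul, hbre]
      have h2 := h1 z hz hz'
      have h3 : z.re ^ 2 + (z.im - y) ^ 2 = s ^ 2 := by
        rw [← hz', ← Complex.normSq_eq_norm_sq, Complex.normSq_apply]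
        simp; ring
      have h4 : ((z.im - y) / s) ^ 2 = 1 - (z.re / s) ^ 2 := by
        field_simp; linarith
      have h5 : z.re / s ≤ 1 := by
        rw [div_le_one hs]; nlinarith [sq_nonneg (z.im - y)]
      have h6 : 0 ≤ z.re / s := by positivity
      rw [h4]
      nlinarith [mul_nonneg hM (mul_nonneg h6 (sub_nonneg.2 h5))])
    (x + y * Complex.I) (by simpa using hx)
    (by rw [mem_ball, dist_eq_norm, add_sub_cancel_right, Complex.norm_real, Real.norm_eq_abs,
      abs_of_nonneg hx]; exact hxs)
  simp only [Pi.sub_apply, Pi.smul_apply, smul_eq_mul, hbre] at key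
  simp only [Complex.add_re, Complex.ofReal_re, Complex.mul_re, Complex.I_re, mul_zero,
    Complex.ofReal_im, Complex.I_im, mul_one, sub_self, add_zero, Complex.add_im, Complex.mul_im,
    zero_add, zero_div] at key
  have : M * (x / s) ^ 2 ≥ 0 := by positivity
  rw [mul_div_assoc]
  nlinarith

open InnerProductSpace Topology in
/-- Gradient estimate up to the flat part of the boundary of a half-disc for a harmonic function
vanishing there. -/
theorem HarmonicOnNhd.exists_norm_deriv_le_of_halfDisc {ρ M : ℝ} (hρ : 0 < ρ) (hM : 0 < M)
    {v : ℂ → ℝ} (hv : HarmonicOnNhd v {z | 0 < z.re ∧ z ∈ ball 0 ρ})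
    (hc : ContinuousOn v {z | 0 ≤ z.re ∧ z ∈ closedBall 0 ρ})
    (h0 : ∀ z, z.re = 0 → z ∈ closedBall 0 ρ → v z = 0)
    (h1 : ∀ z, 0 ≤ z.re → ‖z‖ = ρ → |v z| ≤ M)
    {z : ℂ} (hz : 0 < z.re) (hzρ : ‖z‖ < ρ / 4) :
    ∃ F : ℂ → ℂ, AnalyticAt ℂ F z ∧ v =ᶠ[𝓝 z] (fun w => (F w).re) ∧
      ‖deriv F z‖ ≤ 16 * Real.exp 2 * M / ρ := by
  have upper : ∀ g : ℂ → ℝ, HarmonicOnNhd g {z | 0 < z.re ∧ z ∈ ball 0 ρ} →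
      ContinuousOn g {z | 0 ≤ z.re ∧ z ∈ closedBall 0 ρ} →
      (∀ z, z.re = 0 → z ∈ closedBall 0 ρ → g z = 0) →
      (∀ z, 0 ≤ z.re → ‖z‖ = ρ → g z ≤ M) →
      ∀ w : ℂ, 0 ≤ w.re → ‖w‖ < ρ / 2 → g w ≤ 4 * M * w.re / ρ := by
    intro g hg hgc hg0 hg1 w hw hwρ
    have hle : ∀ z, 0 ≤ z.re → ‖z‖ ≤ ρ → g z ≤ M := by
      intro z hz hzρ
      rcases hzρ.eq_or_lt with h | h
      · exact hg1 z hz h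
      · have := HarmonicOnNhd.nonpos_of_halfDisc (c := 0) (s := ρ) (g := g - fun _ => M)
          (hg.sub (harmonicOnNhd_const M)) (hgc.sub continuousOn_const)
          (fun z hz hz' => by simp [hg0 z hz hz', hM.le])
          (fun z hz hz' => by simpa using hg1 z hz (by simpa using hz')) z hz (by simpa using h)
        simpa using this
    have him : |w.im| < ρ / 2 := (Complex.abs_im_le_norm w).trans_lt hwρ
    have hre : w.re < ρ / 2 := (Complex.re_le_norm w).trans_lt hwρ
    have hsub : ∀ z ∈ closedBall (w.im * Complex.I) (ρ / 2), ‖z‖ < ρ := by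
      intro z hz
      rw [mem_closedBall, dist_eq_norm] at hz
      have := norm_sub_norm_le z (w.im * Complex.I)
      rw [norm_mul, Complex.norm_I, mul_one, Complex.norm_real, Real.norm_eq_abs] at this
      linarith
    have := HarmonicOnNhd.le_mul_re_of_halfDisc (s := ρ / 2) (M := M) (y := w.im) (v := g)
      (by positivity) hM.le
      (hg.mono fun z hz => ⟨hz.1, by simpa using hsub z (ball_subset_closedBall hz.2)⟩)
      (hgc.mono fun z hz => ⟨hz.1, by simpa using (hsub z hz.2).le⟩)
      (fun z hz hz' => hg0 z hz (by simpa using (hsub z hz').le))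
      (fun z hz hz' => hle z hz (hsub z (by rw [mem_closedBall, dist_eq_norm]; exact hz'.le)).le)
      hw hre
    rw [Complex.re_add_im] at this
    refine this.trans_eq ?_
    field_simp; ring
  have habs : ∀ w : ℂ, 0 ≤ w.re → ‖w‖ < ρ / 2 → |v w| ≤ 4 * M * w.re / ρ := by
    intro w hw hwρ
    refine abs_le'.2 ⟨upper v hv hc h0 (fun z hz hz' => le_of_abs_le (h1 z hz hz')) w hw hwρ, ?_⟩
    refine upper (-v) hv.neg hc.neg (fun z hz hz' => by simp [h0 z hz hz'])
      (fun z hz hz' => ?_) w hw hwρ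
    have := neg_le_of_abs_le (h1 z hz hz')
    simp only [Pi.neg_apply]; linarith
  have hball : ∀ w ∈ ball z z.re, 0 < w.re ∧ w.re < 2 * z.re ∧ ‖w‖ < ρ / 2 := by
    intro w hw
    rw [mem_ball, dist_eq_norm] at hw
    have h2 := Complex.abs_re_le_norm (w - z)
    rw [Complex.sub_re] at h2
    have h3 := abs_lt.1 (h2.trans_lt hw)
    have h4 := norm_sub_norm_le w z
    have h5 := Complex.re_le_norm z
    exact ⟨by linarith, by linarith, by linarith⟩
  obtain ⟨F, hF, he⟩ := HarmonicOnNhd.exists_analyticOnNhd_ball_re_eq (f := v) (z := z) (R := z.re)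
    (hv.mono fun w hw => ⟨(hball w hw).1, by
      have := (hball w hw).2.2
      rw [mem_ball_zero_iff]; linarith⟩)
  refine ⟨F, hF z (mem_ball_self hz), ?_, ?_⟩
  · exact Filter.eventually_of_mem (ball_mem_nhds z hz) fun w hw => (he hw).symm
  · refine (norm_deriv_le_of_abs_re_le (m := 8 * M * z.re / ρ) hz (by positivity)
      hF.differentiableOn fun w hw => ?_).trans_eq ?_
    · obtain ⟨ha, hb, hd⟩ := hball w hw
      have h6 : (F w).re = v w := he hw
      rw [h6]
      refine (habs w ha.le hd).trans ?_
      rw [div_le_div_iff_of_pos_right hρ]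
      nlinarith
    · field_simp; ring

theorem ContDiff.fderiv_apply_const {f : ℂ → ℝ} (hf : ContDiff ℝ ∞ f) (e : ℂ) :
    ContDiff ℝ ∞ fun y => fderiv ℝ f y e :=
  (hf.fderiv_right (m := ∞) (by simp)).clm_apply contDiff_const

theorem fderiv_fderiv_apply_const {f : ℂ → ℝ} (hf : ContDiff ℝ ∞ f) (e e' x : ℂ) :
    fderiv ℝ (fun y => fderiv ℝ f y e) x e' = fderiv ℝ (fderiv ℝ f) x e' e := by
  have h : DifferentiableAt ℝ (fderiv ℝ f) x :=
    ((hf.fderiv_right (m := ∞) (by simp)).differentiable (by simp)) x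
  rw [fderiv_clm_apply h (differentiableAt_const e)]
  simp

theorem fderiv_fderiv_apply_comm {f : ℂ → ℝ} (hf : ContDiff ℝ ∞ f) (e e' x : ℂ) :
    fderiv ℝ (fun y => fderiv ℝ f y e) x e' = fderiv ℝ (fun y => fderiv ℝ f y e') x e := by
  rw [fderiv_fderiv_apply_const hf, fderiv_fderiv_apply_const hf]
  exact (hf.contDiffAt.isSymmSndFDerivAt (by simpa using WithTop.coe_le_coe.2 (le_top : (2 : ℕ∞) ≤ ⊤))).eq e' e

open Complex in
theorem ContDiff.laplacian_eq_fderiv {f : ℂ → ℝ} (hf : ContDiff ℝ ∞ f) :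
    Δ f = fun x => fderiv ℝ (fun y => fderiv ℝ f y 1) x 1 +
      fderiv ℝ (fun y => fderiv ℝ f y I) x I := by
  rw [InnerProductSpace.laplacian_eq_iteratedFDeriv_complexPlane]
  ext x
  simp [iteratedFDeriv_two_apply, fderiv_fderiv_apply_const hf]

theorem ContDiff.contDiff_laplacian {f : ℂ → ℝ} (hf : ContDiff ℝ ∞ f) : ContDiff ℝ ∞ (Δ f) := by
  rw [hf.laplacian_eq_fderiv]
  exact ((hf.fderiv_apply_const _).fderiv_apply_const _).add
    ((hf.fderiv_apply_const _).fderiv_apply_const _)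

theorem laplacian_fderiv_apply_comm {f : ℂ → ℝ} (hf : ContDiff ℝ ∞ f) (e : ℂ) :
    Δ (fun y => fderiv ℝ f y e) = fun x => fderiv ℝ (Δ f) x e := by
  have key : ∀ a x : ℂ, fderiv ℝ (fun y => fderiv ℝ (fun z => fderiv ℝ f z e) y a) x a =
      fderiv ℝ (fun y => fderiv ℝ (fun z => fderiv ℝ f z a) y a) x e := by
    intro a x
    rw [funext fun y => fderiv_fderiv_apply_comm hf e a y,
      fderiv_fderiv_apply_comm (hf.fderiv_apply_const a)]
  rw [(hf.fderiv_apply_const e).laplacian_eq_fderiv, hf.laplacian_eq_fderiv]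
  ext x
  rw [key, key, fderiv_fun_add]
  · rfl
  · exact (((hf.fderiv_apply_const _).fderiv_apply_const _).differentiable (by simp)) x
  · exact (((hf.fderiv_apply_const _).fderiv_apply_const _).differentiable (by simp)) x

theorem fderiv_comp_const_sub_apply {g : ℂ → ℝ} (hg : Differentiable ℝ g) (x y e : ℂ) :
    fderiv ℝ (fun y => g (x - y)) y e = -fderiv ℝ g (x - y) e := by
  have h := (hg (x - y)).hasFDerivAt.comp y ((hasFDerivAt_id y).const_sub x)
  rw [HasFDerivAt.fderiv (f := fun y => g (x - y)) h]
  simp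

theorem laplacian_comp_const_sub {f : ℂ → ℝ} (hf : ContDiff ℝ ∞ f) (x : ℂ) :
    Δ (fun y => f (x - y)) = fun y => Δ f (x - y) := by
  have hf' : ContDiff ℝ ∞ fun y => f (x - y) := hf.comp (contDiff_const.sub contDiff_id)
  rw [hf'.laplacian_eq_fderiv, hf.laplacian_eq_fderiv]
  have key : ∀ e y : ℂ, fderiv ℝ (fun y => fderiv ℝ (fun y => f (x - y)) y e) y e =
      fderiv ℝ (fun y => fderiv ℝ f y e) (x - y) e := by
    intro e y
    rw [funext fun y => fderiv_comp_const_sub_apply (hf.differentiable (by simp)) x y e]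
    rw [fderiv_fun_neg, neg_apply,
      fderiv_comp_const_sub_apply (g := fun y => fderiv ℝ f y e)
        ((hf.fderiv_apply_const e).differentiable (by simp)), neg_neg]
  ext y
  rw [key, key]

theorem laplacian_comp_const_smul {f : ℂ → ℝ} (hf : ContDiff ℝ ∞ f) (c : ℝ) :
    Δ (fun y => f (c • y)) = fun y => c ^ 2 * Δ f (c • y) := by
  have hf' : ContDiff ℝ ∞ fun y => f (c • y) := hf.comp (contDiff_const_smul c)
  rw [hf'.laplacian_eq_fderiv, hf.laplacian_eq_fderiv]
  have key : ∀ e y : ℂ, fderiv ℝ (fun y => fderiv ℝ (fun y => f (c • y)) y e) y e =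
      c ^ 2 * fderiv ℝ (fun y => fderiv ℝ f y e) (c • y) e := by
    intro e y
    have h1 : (fun y => fderiv ℝ (fun y => f (c • y)) y e) =
        c • fun y => (fun z => fderiv ℝ f z e) (c • y) := by
      ext z; rw [fderiv_comp_smul]; simp
    rw [h1, fderiv_const_smul]
    · have h2 := fderiv_comp_smul (f := fun z => fderiv ℝ f z e) (x := y) c
      simp only at h2 ⊢
      rw [h2]; simp; ring
    · exact (((hf.fderiv_apply_const e).comp (contDiff_const_smul c)).differentiable (by simp)) y
  ext y
  rw [key, key]; ring

theorem laplacian_eq_zero_of_notMem_tsupport {f : ℂ → ℝ} {x : ℂ} (hx : x ∉ tsupport f) :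
    Δ f x = 0 := by
  have h := InnerProductSpace.laplacian_congr_nhds (notMem_tsupport_iff_eventuallyEq.1 hx)
  rw [h.eq_of_nhds]
  exact congrFun (InnerProductSpace.laplacian_const (c := (0 : ℝ))) x

/-- A smooth function on the line which is the logarithm on `[1, ∞)` and vanishes for small
arguments. -/
noncomputable def cutoffLog (t : ℝ) : ℝ := Real.smoothTransition (2 * t - 1) * Real.log t

theorem cutoffLog_of_one_le {t : ℝ} (ht : 1 ≤ t) : cutoffLog t = Real.log t := by
  rw [cutoffLog, Real.smoothTransition.one_of_one_le (by linarith), one_mul]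

theorem contDiff_cutoffLog : ContDiff ℝ ∞ cutoffLog := by
  rw [contDiff_iff_contDiffAt]
  intro t
  rcases lt_or_ge t (1 / 2) with h | h
  · have : cutoffLog =ᶠ[nhds t] fun _ => (0 : ℝ) := by
      filter_upwards [Iio_mem_nhds h] with s hs
      rw [cutoffLog, Real.smoothTransition.zero_of_nonpos, zero_mul]
      simp only [mem_Iio] at hs; linarith
    exact contDiffAt_const.congr_of_eventuallyEq this
  · refine ContDiffAt.mul ?_ (Real.contDiffAt_log.2 (by linarith))
    exact (Real.smoothTransition.contDiff.comp (by fun_prop)).contDiffAt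

/-- A smooth function in the plane which is `log ‖z‖ / (2 π)`, the fundamental solution of the
Laplace equation, outside the unit disc. -/
noncomputable def smoothedGreen (z : ℂ) : ℝ := (4 * Real.pi)⁻¹ * cutoffLog (Complex.normSq z)

theorem contDiff_normSq : ContDiff ℝ ∞ Complex.normSq := by
  have : (Complex.normSq : ℂ → ℝ) = fun z => Complex.reCLM z * Complex.reCLM z +
      Complex.imCLM z * Complex.imCLM z := by
    ext z; simp [Complex.normSq_apply]
  rw [this]
  exact (Complex.reCLM.contDiff.mul Complex.reCLM.contDiff).add
    (Complex.imCLM.contDiff.mul Complex.imCLM.contDiff)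

theorem contDiff_smoothedGreen : ContDiff ℝ ∞ smoothedGreen :=
  contDiff_const.mul (contDiff_cutoffLog.comp contDiff_normSq)

theorem hasFDerivAt_normSq (z : ℂ) : HasFDerivAt (fun z : ℂ => Complex.normSq z)
    ((2 * z.re) • Complex.reCLM + (2 * z.im) • Complex.imCLM) z := by
  have h1 : HasFDerivAt (fun z : ℂ => z.re) Complex.reCLM z := Complex.reCLM.hasFDerivAt
  have h2 : HasFDerivAt (fun z : ℂ => z.im) Complex.imCLM z := Complex.imCLM.hasFDerivAt
  have h := (h1.mul h1).add (h2.mul h2)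
  refine (h.congr_fderiv ?_).congr_of_eventuallyEq (.of_forall fun w => Complex.normSq_apply w)
  ext
  simp; ring

theorem fderiv_comp_normSq {g : ℝ → ℝ} (z e : ℂ) (hg : DifferentiableAt ℝ g (Complex.normSq z)) :
    fderiv ℝ (fun z => g (Complex.normSq z)) z e =
      deriv g (Complex.normSq z) * (2 * (z.re * e.re + z.im * e.im)) := by
  rw [HasFDerivAt.fderiv (f := fun z => g (Complex.normSq z))
    (hg.hasDerivAt.comp_hasFDerivAt z (hasFDerivAt_normSq z))]
  simp [mul_add, mul_assoc]

theorem laplacian_comp_normSq {g : ℝ → ℝ} (hg : ContDiff ℝ ∞ g) :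
    Δ (fun z : ℂ => g (Complex.normSq z)) =
      fun z => 4 * deriv (fun t => t * deriv g t) (Complex.normSq z) := by
  have hg1 : Differentiable ℝ g := hg.differentiable (by simp)
  have hg' : ContDiff ℝ ∞ (deriv g) := (contDiff_infty_iff_deriv.1 hg).2
  have hg2 : Differentiable ℝ (deriv g) := hg'.differentiable (by simp)
  rw [ContDiff.laplacian_eq_fderiv (f := fun z => g (Complex.normSq z)) (hg.comp contDiff_normSq)]
  ext z
  have h1 : (fun y : ℂ => fderiv ℝ (fun z : ℂ => g (Complex.normSq z)) y 1) =
      fun y => deriv g (Complex.normSq y) * (2 * y.re) := by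
    ext y; rw [fderiv_comp_normSq _ _ (hg1 _)]; simp
  have h2 : (fun y : ℂ => fderiv ℝ (fun z : ℂ => g (Complex.normSq z)) y Complex.I) =
      fun y => deriv g (Complex.normSq y) * (2 * y.im) := by
    ext y; rw [fderiv_comp_normSq _ _ (hg1 _)]; simp
  have hd : HasFDerivAt (fun z : ℂ => deriv g (Complex.normSq z))
      (deriv (deriv g) (Complex.normSq z) • ((2 * z.re) • Complex.reCLM +
        (2 * z.im) • Complex.imCLM)) z :=
    (hg2 _).hasDerivAt.comp_hasFDerivAt z (hasFDerivAt_normSq z)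
  have hre : HasFDerivAt (fun z : ℂ => 2 * z.re) ((2 : ℝ) • Complex.reCLM) z :=
    Complex.reCLM.hasFDerivAt.const_mul 2
  have him : HasFDerivAt (fun z : ℂ => 2 * z.im) ((2 : ℝ) • Complex.imCLM) z :=
    Complex.imCLM.hasFDerivAt.const_mul 2
  rw [h1, h2, (hd.fun_mul hre).fderiv, (hd.fun_mul him).fderiv,
    ((hasDerivAt_id' _).fun_mul (hg2 (Complex.normSq z)).hasDerivAt).deriv, Complex.normSq_apply]
  simp
  ring

theorem deriv_cutoffLog_of_one_lt {t : ℝ} (ht : 1 < t) : deriv cutoffLog t = t⁻¹ := by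
  have : cutoffLog =ᶠ[nhds t] Real.log := by
    filter_upwards [Ioi_mem_nhds ht] with s hs using cutoffLog_of_one_le hs.le
  rw [this.deriv_eq, Real.deriv_log]

theorem mul_deriv_cutoffLog_of_one_lt {t : ℝ} (ht : 1 < t) : t * deriv cutoffLog t = 1 := by
  rw [deriv_cutoffLog_of_one_lt ht, mul_inv_cancel₀ (by linarith)]

theorem contDiff_mul_deriv_cutoffLog : ContDiff ℝ ∞ fun t => t * deriv cutoffLog t :=
  contDiff_id.mul (contDiff_infty_iff_deriv.1 contDiff_cutoffLog).2

theorem laplacian_smoothedGreen (z : ℂ) : Δ smoothedGreen z =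
    Real.pi⁻¹ * deriv (fun t => t * deriv cutoffLog t) (Complex.normSq z) := by
  have h : smoothedGreen = (4 * Real.pi)⁻¹ • fun z => cutoffLog (Complex.normSq z) := rfl
  rw [h, InnerProductSpace.laplacian_smul, laplacian_comp_normSq contDiff_cutoffLog]
  · simp only [smul_eq_mul, mul_inv]; ring
  · exact ((contDiff_cutoffLog.comp contDiff_normSq).of_le
      (WithTop.coe_le_coe.2 (le_top : (2 : ℕ∞) ≤ ⊤))).contDiffAt

theorem laplacian_smoothedGreen_of_one_lt {z : ℂ} (hz : 1 < ‖z‖) : Δ smoothedGreen z = 0 := by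
  have hz' : 1 < Complex.normSq z := by rw [Complex.normSq_eq_norm_sq]; nlinarith
  have : (fun t => t * deriv cutoffLog t) =ᶠ[nhds (Complex.normSq z)] fun _ => (1 : ℝ) := by
    filter_upwards [Ioi_mem_nhds hz'] with s hs using mul_deriv_cutoffLog_of_one_lt hs
  rw [laplacian_smoothedGreen, this.deriv_eq, deriv_const, mul_zero]

theorem integral_laplacian_smoothedGreen : ∫ z, Δ smoothedGreen z = 1 := by
  set M : ℝ → ℝ := fun t => t * deriv cutoffLog t with hM
  have hMd : Differentiable ℝ M := contDiff_mul_deriv_cutoffLog.differentiable (by simp)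
  have h1 : ∫ z, Δ smoothedGreen z = ∫ z : ℂ, (fun r : ℝ => Real.pi⁻¹ * deriv M (r ^ 2)) ‖z‖ := by
    congr 1; ext z; rw [laplacian_smoothedGreen, Complex.normSq_eq_norm_sq]
  have hder : ∀ r : ℝ, deriv (fun r => M (r ^ 2) - 1) r = deriv M (r ^ 2) * (2 * r) := by
    intro r
    have := ((hMd (r ^ 2)).hasDerivAt.comp r (hasDerivAt_pow 2 r)).sub_const 1
    rw [HasDerivAt.deriv (by simpa [Function.comp_def] using this)]
  have hcs : HasCompactSupport fun r : ℝ => M (r ^ 2) - 1 := by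
    refine HasCompactSupport.of_support_subset_isCompact (K := Icc (-1) 1) isCompact_Icc ?_
    intro r hr
    by_contra hn
    refine hr ?_
    have : 1 < r ^ 2 := by
      rw [mem_Icc, ← abs_le] at hn
      push Not at hn
      rw [← sq_abs]; nlinarith
    simp [hM, mul_deriv_cutoffLog_of_one_lt this]
  have hC1 : ContDiff ℝ 1 fun r : ℝ => M (r ^ 2) - 1 :=
    ((contDiff_mul_deriv_cutoffLog.comp (contDiff_id.pow 2)).sub contDiff_const).of_le
      (by exact_mod_cast le_top)
  have h2 := HasCompactSupport.integral_Ioi_deriv_eq hC1 hcs 0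
  rw [h1, integral_fun_norm_addHaar volume (fun r : ℝ => Real.pi⁻¹ * deriv M (r ^ 2))]
  have h3 : ∫ r in Ioi (0 : ℝ), r ^ (Module.finrank ℝ ℂ - 1) • (Real.pi⁻¹ * deriv M (r ^ 2)) =
      (2 * Real.pi)⁻¹ * ∫ r in Ioi (0 : ℝ), deriv (fun r => M (r ^ 2) - 1) r := by
    rw [← integral_const_mul]
    congr 1; ext r
    rw [hder, Complex.finrank_real_complex]
    simp only [smul_eq_mul, mul_inv]
    norm_num; ring
  have hv : volume.real (ball (0 : ℂ) 1) = Real.pi := by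
    simp [Measure.real, Complex.volume_ball]
  rw [h3, h2, hv, Complex.finrank_real_complex]
  have := Real.pi_pos
  simp [hM]

/-- The smoothing of `log ‖z‖ / (2 π)` at scale `δ`. -/
noncomputable def smoothedGreenAt (δ : ℝ) (z : ℂ) : ℝ :=
  smoothedGreen (δ⁻¹ • z) + (2 * Real.pi)⁻¹ * Real.log δ

/-- The potential of a unit dipole at the origin, directed along the real axis. -/
noncomputable def dipole (z : ℂ) : ℝ := (2 * Real.pi)⁻¹ * (z⁻¹).re

theorem contDiff_smoothedGreenAt (δ : ℝ) : ContDiff ℝ ∞ (smoothedGreenAt δ) :=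
  (contDiff_smoothedGreen.comp (contDiff_const_smul _)).add contDiff_const

theorem smoothedGreenAt_of_le {δ : ℝ} (hδ : 0 < δ) {z : ℂ} (hz : δ ≤ ‖z‖) :
    smoothedGreenAt δ z = (4 * Real.pi)⁻¹ * Real.log (Complex.normSq z) := by
  have h1 : Complex.normSq (δ⁻¹ • z) = δ⁻¹ ^ 2 * Complex.normSq z := by
    rw [Complex.normSq_eq_norm_sq, Complex.normSq_eq_norm_sq, norm_smul, mul_pow]
    simp
  have hn : δ ^ 2 ≤ Complex.normSq z := by
    rw [Complex.normSq_eq_norm_sq]; gcongr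
  have h2 : 1 ≤ Complex.normSq (δ⁻¹ • z) := by
    rw [h1, inv_pow, inv_mul_eq_div, one_le_div (by positivity)]; exact hn
  have hpos : 0 < Complex.normSq z := lt_of_lt_of_le (by positivity) hn
  rw [smoothedGreenAt, smoothedGreen, cutoffLog_of_one_le h2, h1,
    Real.log_mul (by positivity) hpos.ne', Real.log_pow, Real.log_inv]
  have := Real.pi_pos
  push_cast
  field_simp
  ring

theorem smoothedGreenAt_eventuallyEq {δ : ℝ} (hδ : 0 < δ) {z : ℂ} (hz : δ < ‖z‖) :
    smoothedGreenAt δ =ᶠ[nhds z] fun z => (4 * Real.pi)⁻¹ * Real.log (Complex.normSq z) := by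
  filter_upwards [(isOpen_lt continuous_const continuous_norm).mem_nhds hz] with w hw
  exact smoothedGreenAt_of_le hδ (le_of_lt hw)

theorem fderiv_smoothedGreenAt {δ : ℝ} (hδ : 0 < δ) {z : ℂ} (hz : δ < ‖z‖) :
    fderiv ℝ (smoothedGreenAt δ) z 1 = dipole z := by
  have hz0 : z ≠ 0 := norm_pos_iff.1 (hδ.trans hz)
  have hn : Complex.normSq z ≠ 0 := Complex.normSq_eq_zero.not.2 hz0
  have hd : DifferentiableAt ℝ (fun t => (4 * Real.pi)⁻¹ * Real.log t) (Complex.normSq z) :=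
    (Real.differentiableAt_log hn).const_mul _
  rw [(smoothedGreenAt_eventuallyEq hδ hz).fderiv_eq, fderiv_comp_normSq z 1 hd,
    deriv_const_mul _ (Real.differentiableAt_log hn), Real.deriv_log, dipole, Complex.inv_re]
  have := Real.pi_pos
  simp
  field_simp
  ring

/-- The Laplacian of the smoothed fundamental solution: a smooth kernel of total mass one,
supported in the disc of radius `δ`. -/
noncomputable def greenMollifier (δ : ℝ) : ℂ → ℝ := Δ (smoothedGreenAt δ)

theorem contDiff_greenMollifier (δ : ℝ) : ContDiff ℝ ∞ (greenMollifier δ) :=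
  (contDiff_smoothedGreenAt δ).contDiff_laplacian

theorem greenMollifier_apply (δ : ℝ) (z : ℂ) :
    greenMollifier δ z = δ⁻¹ ^ 2 * Δ smoothedGreen (δ⁻¹ • z) := by
  have h : smoothedGreenAt δ = (fun z => smoothedGreen (δ⁻¹ • z)) +
      fun _ => (2 * Real.pi)⁻¹ * Real.log δ := rfl
  have hc : ContDiffAt ℝ 2 (fun z => smoothedGreen (δ⁻¹ • z)) z :=
    ((contDiff_smoothedGreen.comp (contDiff_const_smul _)).of_le
      (WithTop.coe_le_coe.2 (le_top : (2 : ℕ∞) ≤ ⊤))).contDiffAt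
  rw [greenMollifier, h, hc.laplacian_add contDiffAt_const, InnerProductSpace.laplacian_const,
    laplacian_comp_const_smul contDiff_smoothedGreen]
  simp

theorem greenMollifier_eq_zero {δ : ℝ} (hδ : 0 < δ) {z : ℂ} (hz : δ < ‖z‖) :
    greenMollifier δ z = 0 := by
  rw [greenMollifier_apply, laplacian_smoothedGreen_of_one_lt, mul_zero]
  rw [norm_smul, norm_inv, Real.norm_eq_abs, abs_of_pos hδ, inv_mul_eq_div, one_lt_div hδ]
  exact hz

theorem hasCompactSupport_greenMollifier {δ : ℝ} (hδ : 0 < δ) :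
    HasCompactSupport (greenMollifier δ) := by
  refine HasCompactSupport.of_support_subset_isCompact (isCompact_closedBall (0 : ℂ) δ) ?_
  intro z hz
  by_contra hn
  rw [mem_closedBall_zero_iff, not_le] at hn
  exact hz (greenMollifier_eq_zero hδ hn)

theorem integral_inv_sq_mul_comp_inv_smul {δ : ℝ} (hδ : 0 < δ) (g : ℂ → ℝ) :
    ∫ z, δ⁻¹ ^ 2 * g (δ⁻¹ • z) = ∫ z, g z := by
  rw [integral_const_mul, Measure.integral_comp_smul, Complex.finrank_real_complex, smul_eq_mul,
    abs_of_pos (by positivity), ← mul_assoc, mul_inv_cancel₀ (by positivity), one_mul]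

theorem integral_greenMollifier {δ : ℝ} (hδ : 0 < δ) : ∫ z, greenMollifier δ z = 1 := by
  simp_rw [greenMollifier_apply]
  rw [integral_inv_sq_mul_comp_inv_smul hδ, integral_laplacian_smoothedGreen]

theorem integral_abs_greenMollifier {δ : ℝ} (hδ : 0 < δ) :
    ∫ z, |greenMollifier δ z| = ∫ z, |Δ smoothedGreen z| := by
  have h : ∀ z, |greenMollifier δ z| = δ⁻¹ ^ 2 * |Δ smoothedGreen (δ⁻¹ • z)| := fun z => by
    rw [greenMollifier_apply, abs_mul, abs_of_pos (by positivity : 0 < δ⁻¹ ^ 2)]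
  simp_rw [h]
  exact integral_inv_sq_mul_comp_inv_smul hδ fun z => |Δ smoothedGreen z|

theorem HasCompactSupport.comp_const_sub {φ : ℂ → ℝ} (hs : HasCompactSupport φ) (x : ℂ) :
    HasCompactSupport fun y => φ (x - y) :=
  hs.comp_homeomorph (Homeomorph.subLeft x)

theorem integrable_mul_comp_const_sub {f φ : ℂ → ℝ} (hf : LocallyIntegrable f volume)
    (hφ : Continuous φ) (hs : HasCompactSupport φ) (x : ℂ) :
    Integrable fun y => f y * φ (x - y) :=
  hf.integrable_smul_right_of_hasCompactSupport (g := fun y => φ (x - y)) (by fun_prop)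
    (hs.comp_const_sub x)

/-- The kernels `greenMollifier δ` are an approximate identity at points of continuity. -/
theorem eventually_abs_integral_greenMollifier_sub_le {f : ℂ → ℝ}
    (hf : LocallyIntegrable f volume) {x : ℂ} (hx : ContinuousAt f x) {η : ℝ} (hη : 0 < η) :
    ∃ δ₀ > 0, ∀ δ, 0 < δ → δ < δ₀ →
      |(∫ y, f y * greenMollifier δ (x - y)) - f x| ≤ η * ∫ z, |Δ smoothedGreen z| := by
  obtain ⟨δ₀, hδ₀, h⟩ := Metric.continuousAt_iff.1 hx η hη
  refine ⟨δ₀, hδ₀, fun δ hδ hlt => ?_⟩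
  have hc := (contDiff_greenMollifier δ).continuous
  have hcs := hasCompactSupport_greenMollifier hδ
  have h1 : (∫ y, f y * greenMollifier δ (x - y)) - f x =
      ∫ y, (f y - f x) * greenMollifier δ (x - y) := by
    have h2 : f x = ∫ y, f x * greenMollifier δ (x - y) := by
      rw [integral_const_mul, integral_sub_left_eq_self (greenMollifier δ),
        integral_greenMollifier hδ, mul_one]
    nth_rw 1 [h2]
    rw [← integral_sub (integrable_mul_comp_const_sub hf hc hcs x)
      (integrable_mul_comp_const_sub (continuous_const.locallyIntegrable) hc hcs x)]
    simp_rw [sub_mul]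
  rw [h1, ← Real.norm_eq_abs, ← integral_abs_greenMollifier hδ,
    ← integral_sub_left_eq_self (fun z => |greenMollifier δ z|) volume x, ← integral_const_mul]
  refine norm_integral_le_of_norm_le ?_ (Eventually.of_forall fun y => ?_)
  · refine ((hc.integrable_of_hasCompactSupport hcs).abs.comp_sub_left x).const_mul η
  · rw [norm_mul, Real.norm_eq_abs, Real.norm_eq_abs]
    by_cases hy : δ < ‖x - y‖
    · rw [greenMollifier_eq_zero hδ hy]; simp
    · refine mul_le_mul_of_nonneg_right ?_ (abs_nonneg _)
      rw [not_lt] at hy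
      have := h (x := y) (by rw [dist_comm, dist_eq_norm]; linarith)
      rw [Real.dist_eq] at this
      exact this.le

theorem contDiff_integral_mul_comp_const_sub {f φ : ℂ → ℝ} (hf : LocallyIntegrable f volume)
    (hφ : ContDiff ℝ ∞ φ) (hs : HasCompactSupport φ) :
    ContDiff ℝ ∞ fun x => ∫ y, f y * φ (x - y) :=
  HasCompactSupport.contDiff_convolution_right (ContinuousLinearMap.mul ℝ ℝ) (n := ⊤) hs hf hφ

theorem fderiv_integral_mul_comp_const_sub {f φ : ℂ → ℝ} (hf : LocallyIntegrable f volume)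
    (hφ : ContDiff ℝ ∞ φ) (hs : HasCompactSupport φ) (x e : ℂ) :
    fderiv ℝ (fun x => ∫ y, f y * φ (x - y)) x e = ∫ y, f y * fderiv ℝ φ (x - y) e := by
  have h1 := HasCompactSupport.hasFDerivAt_convolution_right (ContinuousLinearMap.mul ℝ ℝ) hs hf
    (hφ.of_le (WithTop.coe_le_coe.2 (le_top : (1 : ℕ∞) ≤ ⊤))) x
  have h2 := convolution_precompR_apply (ContinuousLinearMap.mul ℝ ℝ) hf (hs.fderiv ℝ)
    (hφ.continuous_fderiv (by simp)) x e
  rw [HasFDerivAt.fderiv (f := fun x => ∫ y, f y * φ (x - y)) h1, h2]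
  rfl

theorem laplacian_integral_mul_comp_const_sub {f φ : ℂ → ℝ} (hf : LocallyIntegrable f volume)
    (hφ : ContDiff ℝ ∞ φ) (hs : HasCompactSupport φ) (x : ℂ) :
    Δ (fun x => ∫ y, f y * φ (x - y)) x = ∫ y, f y * Δ φ (x - y) := by
  have key : ∀ e : ℂ, HasCompactSupport fun y => fderiv ℝ φ y e := fun e =>
    (hs.fderiv ℝ).comp_left (g := fun L : ℂ →L[ℝ] ℝ => L e) (by simp)
  have key2 : ∀ e : ℂ, fderiv ℝ (fun x => fderiv ℝ (fun x => ∫ y, f y * φ (x - y)) x e) x e =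
      ∫ y, f y * fderiv ℝ (fun y => fderiv ℝ φ y e) (x - y) e := by
    intro e
    rw [funext fun x => fderiv_integral_mul_comp_const_sub hf hφ hs x e,
      fderiv_integral_mul_comp_const_sub hf (hφ.fderiv_apply_const e) (key e)]
  have key3 : ∀ e : ℂ,
      Integrable fun y => f y * fderiv ℝ (fun y => fderiv ℝ φ y e) (x - y) e := fun e =>
    integrable_mul_comp_const_sub hf ((hφ.fderiv_apply_const e).fderiv_apply_const e).continuous
      (((key e).fderiv ℝ).comp_left (g := fun L : ℂ →L[ℝ] ℝ => L e) (by simp)) x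
  rw [(contDiff_integral_mul_comp_const_sub hf hφ hs).laplacian_eq_fderiv, hφ.laplacian_eq_fderiv]
  simp only [key2]
  rw [← integral_add (key3 1) (key3 Complex.I)]
  simp_rw [mul_add]

theorem tsupport_comp_const_sub_subset {φ : ℂ → ℝ} {δ : ℝ} (h : ∀ z, δ < ‖z‖ → φ z = 0) (x : ℂ) :
    tsupport (fun y => φ (x - y)) ⊆ closedBall x δ := by
  refine closure_minimal (fun y hy => ?_) isClosed_closedBall
  by_contra hn
  rw [mem_closedBall, dist_comm, dist_eq_norm, not_le] at hn
  exact hy (h _ hn)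

open InnerProductSpace in
/-- Local form of Weyl's lemma with a dipole source. -/
theorem exists_harmonicOnNhd_ball_add_dipole {f : ℂ → ℝ} {x₀ : ℂ} {r : ℝ} (hr : 0 < r)
    (hf : IntegrableOn f (closedBall x₀ (3 * r)) volume)
    (hcont : ContinuousOn f (closedBall x₀ (3 * r) \ {0}))
    (heq : ∀ ψ : ℂ → ℝ, ContDiff ℝ ∞ ψ → HasCompactSupport ψ → tsupport ψ ⊆ closedBall x₀ (3 * r) →
      ∫ x, f x * Δ ψ x = -(fderiv ℝ ψ 0 1)) :
    ∃ h : ℂ → ℝ, HarmonicOnNhd h (ball x₀ r) ∧ ∀ x ∈ ball x₀ r, x ≠ 0 → f x = h x + dipole x := by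
  set f₁ : ℂ → ℝ := (closedBall x₀ (3 * r)).indicator f with hf₁
  have hf₁i : LocallyIntegrable f₁ volume :=
    ((integrable_indicator_iff isClosed_closedBall.measurableSet).2 hf).locallyIntegrable
  have heq₁ : ∀ ψ : ℂ → ℝ, ContDiff ℝ ∞ ψ → ∀ x ∈ ball x₀ r, tsupport ψ ⊆ closedBall x r →
      ∫ x, f₁ x * Δ ψ x = -(fderiv ℝ ψ 0 1) := by
    intro ψ hψ x hx hsub
    have hsub' : tsupport ψ ⊆ closedBall x₀ (3 * r) :=
      hsub.trans (closedBall_subset_closedBall' (by rw [mem_ball] at hx; linarith))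
    rw [← heq ψ hψ ((isCompact_closedBall x r).of_isClosed_subset (isClosed_tsupport ψ) hsub) hsub']
    congr 1; ext y
    by_cases hy : y ∈ closedBall x₀ (3 * r)
    · rw [hf₁, indicator_of_mem hy]
    · rw [laplacian_eq_zero_of_notMem_tsupport fun h => hy (hsub' h), mul_zero, mul_zero]
  set u : ℝ → ℂ → ℝ := fun δ x => (∫ y, f₁ y * greenMollifier δ (x - y)) -
    fderiv ℝ (smoothedGreenAt δ) x 1 with hu
  have hgc := fun δ => (contDiff_greenMollifier δ).continuous
  have hindep : ∀ δ, 0 < δ → δ < r → ∀ x ∈ ball x₀ r, u δ x = u r x := by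
    intro δ hδ hδr x hx
    have hc1 : ContDiff ℝ ∞ fun z => smoothedGreenAt δ z - smoothedGreenAt r z :=
      (contDiff_smoothedGreenAt δ).sub (contDiff_smoothedGreenAt r)
    have h1 := heq₁ (fun y => (fun z => smoothedGreenAt δ z - smoothedGreenAt r z) (x - y))
      (hc1.comp (contDiff_const.sub contDiff_id)) x hx
      (tsupport_comp_const_sub_subset
        (φ := fun z => smoothedGreenAt δ z - smoothedGreenAt r z) (fun z hz => by
        rw [smoothedGreenAt_of_le hδ (hδr.trans hz).le, smoothedGreenAt_of_le hr hz.le, sub_self]) x)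
    rw [laplacian_comp_const_sub hc1, fderiv_comp_const_sub_apply (hc1.differentiable (by simp)),
      neg_neg, sub_zero, fderiv_fun_sub ((contDiff_smoothedGreenAt δ).differentiable (by simp) x)
      ((contDiff_smoothedGreenAt r).differentiable (by simp) x)] at h1
    have h2 : Δ (fun z => smoothedGreenAt δ z - smoothedGreenAt r z) =
        fun z => greenMollifier δ z - greenMollifier r z := by
      ext z
      exact ContDiffAt.laplacian_sub (f₁ := smoothedGreenAt δ) (f₂ := smoothedGreenAt r)
        ((contDiff_smoothedGreenAt δ).of_le
          (WithTop.coe_le_coe.2 (le_top : (2 : ℕ∞) ≤ ⊤))).contDiffAt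
        ((contDiff_smoothedGreenAt r).of_le
          (WithTop.coe_le_coe.2 (le_top : (2 : ℕ∞) ≤ ⊤))).contDiffAt
    simp only [h2, mul_sub] at h1
    rw [integral_sub
      (integrable_mul_comp_const_sub hf₁i (hgc δ) (hasCompactSupport_greenMollifier hδ) x)
      (integrable_mul_comp_const_sub hf₁i (hgc r) (hasCompactSupport_greenMollifier hr) x)] at h1
    simp only [sub_apply] at h1
    simp only [hu]
    linarith
  refine ⟨u r, fun x hx => ?_, fun x hx hx0 => ?_⟩
  · have hF := contDiff_integral_mul_comp_const_sub hf₁i (contDiff_greenMollifier r)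
      (hasCompactSupport_greenMollifier hr)
    have hG := (contDiff_smoothedGreenAt r).fderiv_apply_const 1
    have h2 : (2 : WithTop ℕ∞) ≤ ∞ := WithTop.coe_le_coe.2 (le_top : (2 : ℕ∞) ≤ ⊤)
    refine ⟨((hF.sub hG).of_le h2).contDiffAt, ?_⟩
    filter_upwards [isOpen_ball.mem_nhds hx] with z hz
    have h3 : Δ (u r) z = Δ (fun x => ∫ y, f₁ y * greenMollifier r (x - y)) z -
        Δ (fun x => fderiv ℝ (smoothedGreenAt r) x 1) z :=
      ContDiffAt.laplacian_sub (hF.of_le h2).contDiffAt (hG.of_le h2).contDiffAt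
    have h4 := heq₁ (fun y => greenMollifier r (z - y))
      ((contDiff_greenMollifier r).comp (contDiff_const.sub contDiff_id)) z hz
      (tsupport_comp_const_sub_subset (fun w hw => greenMollifier_eq_zero hr hw) z)
    rw [laplacian_comp_const_sub (contDiff_greenMollifier r),
      fderiv_comp_const_sub_apply ((contDiff_greenMollifier r).differentiable (by simp)),
      neg_neg, sub_zero] at h4
    rw [h3, laplacian_integral_mul_comp_const_sub hf₁i (contDiff_greenMollifier r)
      (hasCompactSupport_greenMollifier hr), h4,
      laplacian_fderiv_apply_comm (contDiff_smoothedGreenAt r)]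
    simp [greenMollifier]
  · have hfx : f₁ x = f x := indicator_of_mem
      (ball_subset_closedBall (ball_subset_ball (by linarith) hx)) f
    have hca : ContinuousAt f₁ x := by
      have hnh : ball x₀ r \ {0} ∈ nhds x :=
        (isOpen_ball.sdiff isClosed_singleton).mem_nhds ⟨hx, hx0⟩
      have hsub : ball x₀ r ⊆ closedBall x₀ (3 * r) :=
        (ball_subset_ball (by linarith)).trans ball_subset_closedBall
      refine ((hcont.mono (sdiff_subset_sdiff_left hsub)).continuousAt hnh).congr ?_
      filter_upwards [hnh] with y hy
      rw [hf₁, indicator_of_mem (hsub hy.1)]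
    have hx0' : 0 < ‖x‖ := norm_pos_iff.2 hx0
    have hK : 0 ≤ ∫ z, |Δ smoothedGreen z| := integral_nonneg fun z => abs_nonneg _
    set K := ∫ z, |Δ smoothedGreen z|
    have hle : ∀ η > 0, |u r x - (f x - dipole x)| ≤ η * K := by
      intro η hη
      obtain ⟨δ₀, hδ₀, h⟩ := eventually_abs_integral_greenMollifier_sub_le hf₁i hca hη
      obtain ⟨δ, hδ, hδ'⟩ := exists_between (lt_min hδ₀ (lt_min hr hx0'))
      rw [lt_min_iff, lt_min_iff] at hδ'
      rw [← hindep δ hδ hδ'.2.1 x hx, hu]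
      simp only
      rw [fderiv_smoothedGreenAt hδ hδ'.2.2, ← hfx, sub_sub_sub_cancel_right]
      exact h δ hδ hδ'.1
    have hz : |u r x - (f x - dipole x)| = 0 := by
      by_contra hne
      have hp := lt_of_le_of_ne (abs_nonneg _) (Ne.symm hne)
      set q := |u r x - (f x - dipole x)|
      have h1 := hle (q / (2 * (K + 1))) (by positivity)
      rw [div_mul_eq_mul_div, le_div_iff₀ (by positivity)] at h1
      nlinarith
    have := abs_eq_zero.1 hz
    linarith

open InnerProductSpace in
/-- Weyl's lemma with a dipole source. -/
theorem exists_harmonicOnNhd_add_dipole {f : ℂ → ℝ} {E : Set ℂ} (hE : IsOpen E)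
    (hf : LocallyIntegrableOn f E volume) (hcont : ContinuousOn f (E \ {0}))
    (heq : ∀ ψ : ℂ → ℝ, ContDiff ℝ ∞ ψ → HasCompactSupport ψ → tsupport ψ ⊆ E →
      ∫ x, f x * Δ ψ x = -(fderiv ℝ ψ 0 1)) :
    ∃ h : ℂ → ℝ, HarmonicOnNhd h E ∧ ∀ x, x ≠ 0 → f x = h x + dipole x := by
  have hloc : ∀ x₀ ∈ E, ∃ r > 0, ∃ h : ℂ → ℝ, HarmonicOnNhd h (ball x₀ r) ∧
      ∀ x ∈ ball x₀ r, x ≠ 0 → f x = h x + dipole x := by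
    intro x₀ hx₀
    obtain ⟨s, hs, hsub⟩ := Metric.nhds_basis_closedBall.mem_iff.1 (hE.mem_nhds hx₀)
    have hs3 : 3 * (s / 3) = s := by ring
    refine ⟨s / 3, by positivity, exists_harmonicOnNhd_ball_add_dipole (by positivity) ?_ ?_ ?_⟩
    · rw [hs3]; exact hf.integrableOn_compact_subset hsub (isCompact_closedBall _ _)
    · rw [hs3]; exact hcont.mono (sdiff_subset_sdiff_left hsub)
    · rw [hs3]; exact fun ψ h1 h2 h3 => heq ψ h1 h2 (h3.trans hsub)
  choose! r hr h hh hfh using hloc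
  refine ⟨Function.update (fun x => f x - dipole x) 0 (h 0 0), fun x hx => ?_, fun x hx => ?_⟩
  · by_cases hx0 : x = 0
    · subst hx0
      refine (harmonicAt_congr_nhds ?_).2 (hh 0 hx 0 (mem_ball_self (hr 0 hx)))
      filter_upwards [ball_mem_nhds (0 : ℂ) (hr 0 hx)] with y hy
      by_cases hy0 : y = 0
      · subst hy0; simp
      · rw [Function.update_of_ne hy0, hfh 0 hx y hy hy0]; ring
    · refine (harmonicAt_congr_nhds ?_).2 (hh x hx x (mem_ball_self (hr x hx)))
      filter_upwards [ball_mem_nhds x (hr x hx), isOpen_ne.mem_nhds hx0] with y hy hy0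
      rw [Function.update_of_ne hy0, hfh x hx y hy hy0]; ring
  · rw [Function.update_of_ne hx]; ring

/-- The cone of aperture `α` about the negative real axis is the set where this function is
negative. -/
noncomputable def coneGauge (α : ℝ) (z : ℂ) : ℝ := |z.im| + Real.tan (α / 2) * z.re

theorem continuous_coneGauge (α : ℝ) : Continuous (coneGauge α) :=
  (continuous_abs.comp Complex.continuous_im).add (continuous_const.mul Complex.continuous_re)

theorem cos_mul_coneGauge_cpow {α γ : ℝ} (hα : 0 < α) (hα' : α < Real.pi) {z : ℂ}
    (hz : |z.arg| * γ ≤ Real.pi) (hγ : 0 ≤ γ) :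
    Real.cos (α / 2) * coneGauge α (z ^ (γ : ℂ)) =
      ‖z‖ ^ γ * Real.sin (|z.arg| * γ + α / 2) := by
  have hc : Real.cos (α / 2) ≠ 0 :=
    (Real.cos_pos_of_mem_Ioo ⟨by linarith, by linarith⟩).ne'
  have habs : |z.arg * γ| = |z.arg| * γ := by rw [abs_mul, abs_of_nonneg hγ]
  rw [coneGauge, Complex.cpow_ofReal_re, Complex.cpow_ofReal_im, abs_mul,
    abs_of_nonneg (Real.rpow_nonneg (norm_nonneg z) γ),
    Real.abs_sin_eq_sin_abs_of_abs_le_pi (by rw [habs]; exact hz), ← Real.cos_abs (z.arg * γ), habs,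
    Real.sin_add, Real.tan_eq_sin_div_cos]
  field_simp

theorem coneGauge_cpow_pos {α γ : ℝ} (hα : 0 < α) (hα' : α < Real.pi)
    (hγ : γ = (2 * Real.pi - α) / Real.pi) {z : ℂ} (hz : 0 < z.re) :
    0 < coneGauge α (z ^ (γ : ℂ)) := by
  have hπ := Real.pi_pos
  have hγ0 : 0 < γ := by rw [hγ]; apply div_pos <;> linarith
  have hγπ : Real.pi / 2 * γ = Real.pi - α / 2 := by rw [hγ]; field_simp
  have harg : |z.arg| < Real.pi / 2 := Complex.abs_arg_lt_pi_div_two_iff.2 (Or.inl hz)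
  have h1 : |z.arg| * γ < Real.pi - α / 2 := by rw [← hγπ]; gcongr
  have hz0 : z ≠ 0 := fun h => by simp [h] at hz
  have h2 := cos_mul_coneGauge_cpow hα hα' (z := z) (γ := γ) (by linarith) hγ0.le
  have h3 : 0 < Real.sin (|z.arg| * γ + α / 2) :=
    Real.sin_pos_of_pos_of_lt_pi (by positivity) (by linarith)
  have h4 : 0 < Real.cos (α / 2) := Real.cos_pos_of_mem_Ioo ⟨by linarith, by linarith⟩
  have h5 : 0 < ‖z‖ ^ γ := Real.rpow_pos_of_pos (norm_pos_iff.2 hz0) _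
  have h6 : 0 < Real.cos (α / 2) * coneGauge α (z ^ (γ : ℂ)) := by rw [h2]; positivity
  exact (pos_iff_pos_of_mul_pos h6).1 h4

theorem coneGauge_cpow_eq_zero {α γ : ℝ} (hα : 0 < α) (hα' : α < Real.pi)
    (hγ : γ = (2 * Real.pi - α) / Real.pi) {z : ℂ} (hz : z.re = 0) :
    coneGauge α (z ^ (γ : ℂ)) = 0 := by
  have hπ := Real.pi_pos
  have hγ0 : 0 < γ := by rw [hγ]; apply div_pos <;> linarith
  by_cases hz0 : z = 0
  · rw [hz0, Complex.zero_cpow (by exact_mod_cast hγ0.ne')]; simp [coneGauge]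
  have hγπ : Real.pi / 2 * γ = Real.pi - α / 2 := by rw [hγ]; field_simp
  have harg : |z.arg| = Real.pi / 2 := by
    refine le_antisymm (Complex.abs_arg_le_pi_div_two_iff.2 hz.ge) ?_
    by_contra! h
    rcases Complex.abs_arg_lt_pi_div_two_iff.1 h with h' | h'
    · exact absurd hz h'.ne'
    · exact hz0 h'
  have h2 := cos_mul_coneGauge_cpow hα hα' (z := z) (γ := γ)
    (by rw [harg, hγπ]; linarith) hγ0.le
  rw [harg, hγπ, sub_add_cancel, Real.sin_pi, mul_zero] at h2
  have h4 : 0 < Real.cos (α / 2) := Real.cos_pos_of_mem_Ioo ⟨by linarith, by linarith⟩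
  exact (mul_eq_zero.1 h2).resolve_left h4.ne'

theorem abs_arg_lt_of_coneGauge_pos {α : ℝ} (hα : 0 < α) (hα' : α < Real.pi) {z : ℂ}
    (hz : 0 < coneGauge α z) : |z.arg| < Real.pi - α / 2 := by
  have h2 := cos_mul_coneGauge_cpow hα hα' (z := z) (γ := 1)
    (by rw [mul_one]; exact Complex.abs_arg_le_pi z) zero_le_one
  rw [Complex.ofReal_one, Complex.cpow_one, Real.rpow_one, mul_one] at h2
  have h4 : 0 < Real.cos (α / 2) := Real.cos_pos_of_mem_Ioo ⟨by linarith, by linarith⟩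
  by_contra! h
  have h5 : Real.sin (|z.arg| + α / 2) ≤ 0 := by
    have := Real.sin_nonneg_of_nonneg_of_le_pi (x := |z.arg| + α / 2 - Real.pi) (by linarith)
      (by linarith [Complex.abs_arg_le_pi z])
    rw [Real.sin_sub_pi] at this
    linarith
  have h6 := mul_pos h4 hz
  have h7 := mul_nonneg (norm_nonneg z) (neg_nonneg.2 h5)
  linarith

theorem cpow_of_coneGauge_pos {α β γ : ℝ} (hα : 0 < α) (hα' : α < Real.pi)
    (hβ : β = Real.pi / (2 * Real.pi - α)) (hγ : γ = (2 * Real.pi - α) / Real.pi) {z : ℂ}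
    (hz : 0 < coneGauge α z) :
    0 < (z ^ (β : ℂ)).re ∧ (z ^ (β : ℂ)) ^ (γ : ℂ) = z ∧ z ∈ Complex.slitPlane := by
  have hπ := Real.pi_pos
  have hd : 0 < 2 * Real.pi - α := by linarith
  have hβ0 : 0 < β := by rw [hβ]; positivity
  have hz0 : z ≠ 0 := fun h => by simp [h, coneGauge] at hz
  have harg := abs_arg_lt_of_coneGauge_pos hα hα' hz
  have hβγ : β * γ = 1 := by
    rw [hβ, hγ, div_mul_div_cancel₀ hd.ne', div_self hπ.ne']
  have h1 : |z.arg * β| < Real.pi / 2 := by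
    rw [abs_mul, abs_of_pos hβ0]
    calc |z.arg| * β < (Real.pi - α / 2) * β := by gcongr
      _ = (2 * Real.pi - α) * β / 2 := by ring
      _ = Real.pi / 2 := by rw [hβ, mul_div_cancel₀ _ hd.ne']
  rw [abs_lt] at h1
  refine ⟨?_, ?_, ?_⟩
  · rw [Complex.cpow_ofReal_re]
    exact mul_pos (Real.rpow_pos_of_pos (norm_pos_iff.2 hz0) _)
      (Real.cos_pos_of_mem_Ioo ⟨by linarith, by linarith⟩)
  · have him : (Complex.log z * β).im = z.arg * β := by
      rw [Complex.im_mul_ofReal, Complex.log_im]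
    rw [← Complex.cpow_mul _ (by rw [him]; linarith) (by rw [him]; linarith), ← Complex.ofReal_mul,
      hβγ, Complex.ofReal_one, Complex.cpow_one]
  · rw [Complex.mem_slitPlane_iff_arg]
    refine ⟨fun h => ?_, hz0⟩
    rw [h, abs_of_pos hπ] at harg
    linarith

theorem mem_closure_of_coneGauge_nonpos {α R : ℝ} (hα : 0 < α) (hα' : α < Real.pi) {D : Set ℂ}
    (hD : D ∩ ball 0 R = {z | coneGauge α z < 0} ∩ ball 0 R) {z : ℂ} (hz : z ∈ ball 0 R)
    (hq : coneGauge α z ≤ 0) : z ∈ closure D := by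
  have ht : 0 < Real.tan (α / 2) := Real.tan_pos_of_pos_of_lt_pi_div_two (by linarith) (by linarith)
  have hlim : Tendsto (fun t : ℝ => z - t) (nhdsWithin 0 (Ioi 0)) (nhds z) := by
    have : ContinuousAt (fun t : ℝ => z - t) 0 := by fun_prop
    have h := this.tendsto
    simp only [Complex.ofReal_zero, sub_zero] at h
    exact h.mono_left nhdsWithin_le_nhds
  refine mem_closure_of_tendsto hlim ?_
  filter_upwards [hlim.eventually (isOpen_ball.mem_nhds hz), self_mem_nhdsWithin] with t ht1 ht2
  have h : z - t ∈ D ∩ ball 0 R := by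
    rw [hD]
    refine ⟨?_, ht1⟩
    have h3 : coneGauge α (z - t) = coneGauge α z - Real.tan (α / 2) * t := by
      simp [coneGauge]; ring
    simp only [mem_ofPred_eq, h3]
    have := mul_pos ht ht2
    linarith
  exact h.1

theorem notMem_closure_of_coneGauge_pos {α R : ℝ} {D : Set ℂ}
    (hD : D ∩ ball 0 R = {z | coneGauge α z < 0} ∩ ball 0 R) {z : ℂ} (hz : z ∈ ball 0 R)
    (hq : 0 < coneGauge α z) : z ∉ closure D := by
  rw [_root_.mem_closure_iff]
  push Not
  refine ⟨{z | 0 < coneGauge α z} ∩ ball 0 R,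
    (isOpen_lt continuous_const (continuous_coneGauge α)).inter isOpen_ball, ⟨hq, hz⟩, ?_⟩
  ext w
  simp only [mem_inter_iff, mem_ofPred_eq, mem_empty_iff_false, iff_false]
  rintro ⟨⟨h1, h2⟩, h3⟩
  have h4 : w ∈ {z | coneGauge α z < 0} ∩ ball 0 R := hD ▸ ⟨h3, h2⟩
  exact absurd h4.1 (not_lt.2 h1.le)

theorem notMem_of_coneGauge_nonneg {α R : ℝ} {D : Set ℂ}
    (hD : D ∩ ball 0 R = {z | coneGauge α z < 0} ∩ ball 0 R) {z : ℂ} (hz : z ∈ ball 0 R)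
    (hq : 0 ≤ coneGauge α z) : z ∉ D := fun h => by
  have h4 : z ∈ {z | coneGauge α z < 0} ∩ ball 0 R := hD ▸ ⟨h, hz⟩
  exact absurd h4.1 (not_lt.2 hq)

theorem mem_frontier_of_coneGauge_eq_zero {α R : ℝ} (hα : 0 < α) (hα' : α < Real.pi) {D : Set ℂ}
    (hDo : IsOpen D) (hD : D ∩ ball 0 R = {z | coneGauge α z < 0} ∩ ball 0 R) {z : ℂ}
    (hz : z ∈ ball 0 R) (hq : coneGauge α z = 0) : z ∈ frontier D := by
  rw [hDo.frontier_eq]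
  exact ⟨mem_closure_of_coneGauge_nonpos hα hα' hD hz hq.le,
    notMem_of_coneGauge_nonneg hD hz hq.ge⟩

theorem half_le_norm_sub_of_mem_closure {α R : ℝ} (hα : 0 < α) (hα' : α < Real.pi) {D : Set ℂ}
    (hR : 1 ≤ R) (hD : D ∩ ball 0 R = {z | coneGauge α z < 0} ∩ ball 0 R) {z : ℂ}
    (hz : z ∈ closure D) : 1 / 2 ≤ ‖z - 1 / 2‖ := by
  have ht : 0 < Real.tan (α / 2) := Real.tan_pos_of_pos_of_lt_pi_div_two (by linarith) (by linarith)
  by_contra! h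
  refine notMem_closure_of_coneGauge_pos hD (z := z) ?_ ?_ hz
  · rw [mem_ball_zero_iff]
    have := norm_sub_norm_le z (1 / 2)
    norm_num at this h
    linarith
  · have h1 := (Complex.abs_re_le_norm (z - 1 / 2)).trans_lt h
    simp only [Complex.sub_re] at h1
    norm_num at h1
    have h2 := (abs_lt.1 h1).1
    have : 0 < Real.tan (α / 2) * z.re := mul_pos ht (by linarith)
    have := abs_nonneg z.im
    rw [coneGauge]; linarith

/-- Removal of a simple pole. -/
theorem exists_analyticAt_inv_sub_eq {P : ℂ → ℂ} {a : ℂ} (hP : AnalyticAt ℂ P a)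
    (hd : deriv P a ≠ 0) : ∃ B : ℂ → ℂ, AnalyticAt ℂ B a ∧
      ∀ z, z ≠ a → (P z - P a)⁻¹ = (deriv P a)⁻¹ / (z - a) + B z := by
  have key : ∀ f : ℂ → ℂ, AnalyticAt ℂ f a → AnalyticAt ℂ (dslope f a) a := by
    intro f hf
    obtain ⟨U, hU, hd⟩ := hf.exists_mem_nhds_analyticOnNhd
    exact ((Complex.differentiableOn_dslope hU).2 hd.differentiableOn).analyticAt hU
  have hs := key P hP
  have hsa : dslope P a a = deriv P a := dslope_same P a
  have hinv : AnalyticAt ℂ (fun z => (dslope P a z)⁻¹) a := hs.inv (by rwa [hsa])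
  refine ⟨dslope (fun z => (dslope P a z)⁻¹) a, key _ hinv, fun z hz => ?_⟩
  have hza : z - a ≠ 0 := sub_ne_zero.2 hz
  have h1 : P z - P a = (z - a) * dslope P a z := by
    have := sub_smul_dslope P a z
    rw [smul_eq_mul] at this
    exact this.symm
  have h2 := sub_smul_dslope (fun z => (dslope P a z)⁻¹) a z
  rw [smul_eq_mul, hsa] at h2
  have h3 : (dslope P a z)⁻¹ =
      (z - a) * dslope (fun z => (dslope P a z)⁻¹) a z + (deriv P a)⁻¹ := by rw [h2]; ring
  rw [h1, mul_inv, h3, mul_add, inv_mul_cancel_left₀ hza]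
  ring

theorem abs_dipole_le (z : ℂ) : |dipole z| ≤ ‖z‖⁻¹ / 2 := by
  have hπ := Real.pi_gt_three
  rw [dipole, abs_mul, abs_of_pos (by positivity), ← norm_inv]
  have h1 := Complex.abs_re_le_norm z⁻¹
  have h2 : (2 * Real.pi)⁻¹ ≤ 1 / 2 := by
    rw [inv_le_comm₀ (by positivity) (by norm_num)]; linarith
  calc (2 * Real.pi)⁻¹ * |z⁻¹.re| ≤ 1 / 2 * ‖z⁻¹‖ := by gcongr
    _ = ‖z⁻¹‖ / 2 := by ring

theorem abs_dipole_le_one {z : ℂ} (hz : 1 / 2 ≤ ‖z‖) : |dipole z| ≤ 1 := by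
  refine (abs_dipole_le z).trans ?_
  have : ‖z‖⁻¹ ≤ 2 := by
    rw [inv_le_comm₀ (by linarith) (by norm_num)]; linarith
  linarith

theorem continuousAt_dipole {z : ℂ} (hz : z ≠ 0) : ContinuousAt dipole z :=
  continuousAt_const.mul (Complex.continuous_re.continuousAt.comp (continuousAt_inv₀ hz))

theorem tendsto_dipole_sub (p : ℂ) :
    Tendsto (fun z => dipole (z - p)) (Bornology.cobounded ℂ) (nhds 0) := by
  have h1 : Tendsto dipole (Bornology.cobounded ℂ) (nhds 0) := by
    have h := (Complex.continuous_re.tendsto 0).comp (tendsto_inv₀_cobounded (α := ℂ))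
    have h2 := h.const_mul (2 * Real.pi)⁻¹
    rw [Complex.zero_re, mul_zero] at h2
    exact h2
  exact h1.comp (tendsto_sub_const_cobounded p)

open InnerProductSpace in
/-- A dipole solution splits into the free dipole and a remainder, which is bounded, as is the
unknown boundary value, if the inclusion keeps its distance from the dipole. -/
theorem abs_le_of_dipole_splitting {D : Set ℂ} (hDo : IsOpen D) (hDb : Bornology.IsBounded D)
    (hDn : D.Nonempty) {p : ℂ} (hp : ∀ z ∈ closure D, 1 / 2 ≤ ‖z - p‖) {f h : ℂ → ℝ} {c₀ : ℝ}
    (hh : HarmonicOnNhd h (closure D)ᶜ) (hfh : ∀ z, z ≠ p → f z = h z + dipole (z - p))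
    (hfc : ContinuousOn f (Dᶜ \ {p})) (hfD : ∀ z ∈ frontier D, f z = c₀)
    (hf0 : Tendsto f (Bornology.cobounded ℂ) (nhds 0)) :
    ContinuousOn h Dᶜ ∧ |c₀| ≤ 1 ∧ ∀ z ∈ Dᶜ, |h z| ≤ 2 := by
  have hne : ∀ z ∈ closure D, z ≠ p := fun z hz h => by
    have := hp z hz
    rw [h, sub_self, norm_zero] at this
    linarith
  have hcont : ContinuousOn h Dᶜ := by
    intro z hz
    by_cases hcl : z ∈ closure D
    · have hzp := hne z hcl
      have h1 : ContinuousWithinAt (fun z => f z - dipole (z - p)) (Dᶜ \ {p}) z :=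
        (hfc z ⟨hz, hzp⟩).sub ((ContinuousAt.comp (g := dipole) (f := fun z => z - p)
          (continuousAt_dipole (sub_ne_zero.2 hzp)) (by fun_prop)).continuousWithinAt)
      have h2 : ContinuousWithinAt h (Dᶜ \ {p}) z := by
        refine h1.congr (fun w hw => ?_) ?_
        · rw [hfh w hw.2]; ring
        · rw [hfh z hzp]; ring
      exact h2.mono_of_mem_nhdsWithin (inter_mem_nhdsWithin _ (isOpen_ne.mem_nhds hzp))
    · exact (hh z hcl).1.continuousAt.continuousWithinAt
  have hlim : Tendsto h (Bornology.cobounded ℂ) (nhds 0) := by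
    have h1 := hf0.sub (tendsto_dipole_sub p)
    rw [sub_zero] at h1
    refine h1.congr' ?_
    filter_upwards [Bornology.isBounded_def.1 (Bornology.isBounded_singleton (x := p))] with z hz
    rw [hfh z hz]; ring
  have hneg : Tendsto (-h) (Bornology.cobounded ℂ) (nhds 0) := by
    have h1 := hlim.neg
    rw [neg_zero] at h1
    exact h1
  have hfr : ∀ z ∈ frontier D, |h z - c₀| ≤ 1 := by
    intro z hz
    have hcl := frontier_subset_closure hz
    have h1 := hfh z (hne z hcl)
    rw [hfD z hz] at h1
    rw [h1, sub_add_cancel_left, abs_neg]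
    exact abs_dipole_le_one (hp z hcl)
  have hup := HarmonicOnNhd.le_of_forall_frontier_le_exterior hDo hDn hh hcont hlim (m := c₀ + 1)
    fun z hz => by linarith [(abs_le.1 (hfr z hz)).2]
  have hlo := HarmonicOnNhd.le_of_forall_frontier_le_exterior hDo hDn hh.neg hcont.neg
    hneg (m := 1 - c₀)
    fun z hz => by
      have := (abs_le.1 (hfr z hz)).1
      simp only [Pi.neg_apply]; linarith
  have hev : ∀ᶠ z in Bornology.cobounded ℂ, z ∈ Dᶜ := Bornology.isBounded_def.1 hDb
  have h1 : 0 ≤ c₀ + 1 := le_of_tendsto hlim (hev.mono hup)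
  have h2 : 0 ≤ 1 - c₀ := le_of_tendsto hneg (hev.mono hlo)
  refine ⟨hcont, abs_le.2 ⟨by linarith, by linarith⟩, fun z hz => abs_le.2 ⟨?_, ?_⟩⟩
  · have := hlo z hz
    simp only [Pi.neg_apply] at this; linarith
  · linarith [hup z hz]

theorem cpow_cpow_of_re_nonneg {α β γ : ℝ} (hα : 0 < α) (hα' : α < Real.pi)
    (hβ : β = Real.pi / (2 * Real.pi - α)) (hγ : γ = (2 * Real.pi - α) / Real.pi) {z : ℂ}
    (hz : 0 ≤ z.re) : (z ^ (γ : ℂ)) ^ (β : ℂ) = z := by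
  have hπ := Real.pi_pos
  have hd : 0 < 2 * Real.pi - α := by linarith
  have hγ0 : 0 < γ := by rw [hγ]; positivity
  have hβγ : γ * β = 1 := by
    rw [hβ, hγ, div_mul_div_cancel₀ hπ.ne', div_self hd.ne']
  have h1 : |z.arg * γ| ≤ Real.pi - α / 2 := by
    rw [abs_mul, abs_of_pos hγ0]
    calc |z.arg| * γ ≤ Real.pi / 2 * γ := by
          gcongr; exact Complex.abs_arg_le_pi_div_two_iff.2 hz
      _ = Real.pi - α / 2 := by rw [hγ]; field_simp
  rw [abs_le] at h1
  have him : (Complex.log z * γ).im = z.arg * γ := by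
    rw [Complex.im_mul_ofReal, Complex.log_im]
  rw [← Complex.cpow_mul _ (by rw [him]; linarith) (by rw [him]; linarith), ← Complex.ofReal_mul,
    hβγ, Complex.ofReal_one, Complex.cpow_one]

/-- The pole of the dipole potential, in the coordinate which flattens the sector. -/
theorem exists_remainder_of_dipole_pole {α β γ a A : ℝ} (hα : 0 < α) (hα' : α < Real.pi)
    (hβ : β = Real.pi / (2 * Real.pi - α)) (hγ : γ = (2 * Real.pi - α) / Real.pi)
    (ha : a = (1 / 2 : ℝ) ^ β) (hA : A = (γ * a ^ (γ - 1))⁻¹) :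
    ∃ B : ℂ → ℂ, (∀ z : ℂ, 0 < z.re → AnalyticAt ℂ B z) ∧ ContinuousOn B {z : ℂ | 0 ≤ z.re} ∧
      ∀ z : ℂ, 0 ≤ z.re → z ≠ a → (z ^ (γ : ℂ) - 1 / 2)⁻¹ = A / (z - a) + B z := by
  have hπ := Real.pi_pos
  have hd : 0 < 2 * Real.pi - α := by linarith
  have hγ0 : 0 < γ := by rw [hγ]; positivity
  have ha0 : 0 < a := by rw [ha]; positivity
  have hβγ : β * γ = 1 := by
    rw [hβ, hγ, div_mul_div_cancel₀ hd.ne', div_self hπ.ne']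
  have haγ : (a : ℂ) ^ (γ : ℂ) = 1 / 2 := by
    rw [← Complex.ofReal_cpow ha0.le, ha, ← Real.rpow_mul (by norm_num), hβγ, Real.rpow_one]
    norm_num
  have hslit : ∀ z : ℂ, 0 < z.re → z ∈ Complex.slitPlane := fun z hz => Or.inl hz
  have hPan : ∀ z : ℂ, 0 < z.re → AnalyticAt ℂ (fun z : ℂ => z ^ (γ : ℂ)) z := fun z hz =>
    analyticAt_id.cpow analyticAt_const (hslit z hz)
  have hderiv : deriv (fun z : ℂ => z ^ (γ : ℂ)) a = ((A⁻¹ : ℝ) : ℂ) := by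
    rw [((hasDerivAt_id' (a : ℂ)).cpow_const (c := (γ : ℂ)) (hslit _ (by simpa using ha0))).deriv,
      hA, inv_inv]
    push_cast
    rw [Complex.ofReal_cpow ha0.le]
    push_cast
    ring
  have hA0 : A ≠ 0 := by rw [hA]; positivity
  obtain ⟨B₀, hB₀, hB₀'⟩ := exists_analyticAt_inv_sub_eq (hPan a (by simpa using ha0))
    (by rw [hderiv]; exact_mod_cast inv_ne_zero hA0)
  rw [hderiv] at hB₀'
  simp only [haγ, Complex.ofReal_inv, inv_inv] at hB₀'
  have hinj : ∀ z : ℂ, 0 ≤ z.re → z ≠ a → z ^ (γ : ℂ) - 1 / 2 ≠ 0 := by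
    intro z hz hza h0
    refine hza ?_
    rw [← cpow_cpow_of_re_nonneg hα hα' hβ hγ hz, sub_eq_zero.1 h0, ← haγ,
      cpow_cpow_of_re_nonneg hα hα' hβ hγ (by simpa using ha0.le)]
  have hB₀an : ∀ z : ℂ, 0 < z.re → AnalyticAt ℂ B₀ z := by
    intro z hz
    by_cases hza : z = a
    · rw [hza]; exact hB₀
    · have h1 : AnalyticAt ℂ (fun z : ℂ => (z ^ (γ : ℂ) - 1 / 2)⁻¹ - A / (z - a)) z :=
        (((hPan z hz).sub analyticAt_const).inv (hinj z hz.le hza)).sub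
          (analyticAt_const.div (analyticAt_id.sub analyticAt_const) (sub_ne_zero.2 hza))
      refine h1.congr ?_
      filter_upwards [isOpen_ne.mem_nhds hza] with w hw
      rw [hB₀' w hw]; ring
  refine ⟨B₀, hB₀an, fun z hz => ?_, fun z _ hza => hB₀' z hza⟩
  rcases (show 0 ≤ z.re from hz).eq_or_lt with h | h
  · have hza : z ≠ a := fun h' => by rw [h', Complex.ofReal_re] at h; linarith
    have h1 : ContinuousAt (fun z : ℂ => (z ^ (γ : ℂ) - 1 / 2)⁻¹ - A / (z - a)) z := by
      refine ContinuousAt.sub (ContinuousAt.inv₀ (ContinuousAt.sub ?_ continuousAt_const)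
        (hinj z hz hza)) (continuousAt_const.div (by fun_prop) (sub_ne_zero.2 hza))
      exact Complex.continuousAt_cpow_const_of_re_pos (Or.inl hz) (by simpa using hγ0)
    refine (h1.congr ?_).continuousWithinAt
    filter_upwards [isOpen_ne.mem_nhds hza] with w hw
    rw [hB₀' w hw]; ring
  · exact (hB₀an z h).continuousAt.continuousWithinAt

/-- The derivative of the principal part `1 / (z + a) + 1 / (z - a)` near the origin. -/
theorem norm_inv_sq_add_inv_sq_bounds {a : ℝ} (ha : 0 < a) {z : ℂ} (hz : ‖z‖ ≤ a / 2) :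
    1 / (2 * a ^ 2) ≤ ‖((z + a) ^ 2)⁻¹ + ((z - a) ^ 2)⁻¹‖ ∧
      ‖((z + a) ^ 2)⁻¹ + ((z - a) ^ 2)⁻¹‖ ≤ 8 / a ^ 2 := by
  have hna : ‖(a : ℂ)‖ = a := by rw [Complex.norm_real, Real.norm_eq_abs, abs_of_pos ha]
  have h1 : a / 2 ≤ ‖z + a‖ := by
    have := norm_sub_norm_le (a : ℂ) (-z)
    rw [norm_neg, sub_neg_eq_add, add_comm (a : ℂ) z] at this; linarith
  have h2 : a / 2 ≤ ‖z - a‖ := by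
    have := norm_sub_norm_le (a : ℂ) z
    rw [norm_sub_rev] at this; linarith
  have hp : 0 < ‖z + a‖ := by linarith
  have hm : 0 < ‖z - a‖ := by linarith
  have hpa : z + a ≠ 0 := norm_pos_iff.1 hp
  have hma : z - a ≠ 0 := norm_pos_iff.1 hm
  constructor
  · have heq : ((z + a) ^ 2)⁻¹ + ((z - a) ^ 2)⁻¹ =
        2 * (z ^ 2 + a ^ 2) / (z ^ 2 - (a : ℂ) ^ 2) ^ 2 := by
      have : z ^ 2 - (a : ℂ) ^ 2 = (z + a) * (z - a) := by ring
      rw [this]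
      field_simp
      ring
    have hz2 : ‖z ^ 2‖ ≤ a ^ 2 / 4 := by
      rw [norm_pow]
      calc ‖z‖ ^ 2 ≤ (a / 2) ^ 2 := by gcongr
        _ = a ^ 2 / 4 := by ring
    have ha2 : ‖(a : ℂ) ^ 2‖ = a ^ 2 := by rw [norm_pow, hna]
    have hnum : 3 / 4 * a ^ 2 ≤ ‖z ^ 2 + (a : ℂ) ^ 2‖ := by
      have := norm_sub_norm_le ((a : ℂ) ^ 2) (-z ^ 2)
      rw [norm_neg, sub_neg_eq_add, add_comm, ha2] at this; linarith
    have hden : ‖z ^ 2 - (a : ℂ) ^ 2‖ ≤ 5 / 4 * a ^ 2 := by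
      have := norm_sub_le (z ^ 2) ((a : ℂ) ^ 2)
      rw [ha2] at this; linarith
    have hden0 : 0 < ‖z ^ 2 - (a : ℂ) ^ 2‖ := by
      have : z ^ 2 - (a : ℂ) ^ 2 = (z + a) * (z - a) := by ring
      rw [this, norm_mul]; positivity
    rw [heq, norm_div, norm_mul, norm_pow, Complex.norm_ofNat, div_le_div_iff₀ (by positivity)
      (by positivity)]
    have h3 : ‖z ^ 2 - (a : ℂ) ^ 2‖ ^ 2 ≤ (5 / 4 * a ^ 2) ^ 2 := by gcongr
    nlinarith [mul_le_mul_of_nonneg_right hnum (by positivity : 0 ≤ 4 * a ^ 2),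
      (by positivity : 0 ≤ a ^ 4)]
  · refine (norm_add_le _ _).trans ?_
    have h3 : ∀ w : ℂ, a / 2 ≤ ‖w‖ → ‖(w ^ 2)⁻¹‖ ≤ 4 / a ^ 2 := by
      intro w hw
      rw [norm_inv, norm_pow]
      calc (‖w‖ ^ 2)⁻¹ ≤ ((a / 2) ^ 2)⁻¹ := by gcongr
        _ = 4 / a ^ 2 := by field_simp; norm_num
    calc _ ≤ 4 / a ^ 2 + 4 / a ^ 2 := add_le_add (h3 _ h1) (h3 _ h2)
      _ = 8 / a ^ 2 := by ring

open InnerProductSpace in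
/-- In the coordinate `ζ = z ^ β` flattening the boundary of the corner, a dipole solution is the
sum of a constant, the dipole solution in the half-plane, and a remainder with small gradient. -/
theorem exists_flattened_remainder {α β γ a A ρ R : ℝ} (hα : 0 < α) (hα' : α < Real.pi)
    (hβ : β = Real.pi / (2 * Real.pi - α)) (hγ : γ = (2 * Real.pi - α) / Real.pi)
    (ha : a = (1 / 2 : ℝ) ^ β) (hA : A = (γ * a ^ (γ - 1))⁻¹) (hρ : 2 ≤ ρ) (hR : ρ ^ γ < R)
    {D : Set ℂ} (hDo : IsOpen D) (hDb : Bornology.IsBounded D)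
    (hD : D ∩ ball 0 R = {z | coneGauge α z < 0} ∩ ball 0 R)
    {f h : ℂ → ℝ} {c₀ : ℝ} (hh : HarmonicOnNhd h (closure D)ᶜ)
    (hfh : ∀ z, z ≠ 1 / 2 → f z = h z + dipole (z - 1 / 2))
    (hfc : ContinuousOn f (Dᶜ \ {1 / 2})) (hfD : ∀ z ∈ frontier D, f z = c₀)
    (hf0 : Tendsto f (Bornology.cobounded ℂ) (nhds 0))
    {ζ : ℂ} (hζ : 0 < ζ.re) (hζn : ‖ζ‖ < 1 / 2) :
    ∃ F : ℂ → ℂ, AnalyticAt ℂ F ζ ∧ ‖deriv F ζ‖ ≤ 16 * Real.exp 2 * (4 + 2 * A) / ρ ∧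
      ∀ᶠ w : ℂ in nhds ζ, w ≠ a → w ^ (γ : ℂ) ≠ 1 / 2 →
        f (w ^ (γ : ℂ)) = (F w).re + c₀ +
          (2 * Real.pi)⁻¹ * ((A : ℂ) * ((w + a)⁻¹ + (w - a)⁻¹)).re := by
  have hπ := Real.pi_pos
  have hd : 0 < 2 * Real.pi - α := by linarith
  have hβ0 : 0 < β := by rw [hβ]; positivity
  have hγ1 : 1 ≤ γ := by rw [hγ, le_div_iff₀ hπ]; linarith
  have hγ0 : 0 < γ := by linarith
  have ha0 : 0 < a := by rw [ha]; positivity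
  have ha1 : a ≤ 1 := by
    rw [ha]; exact Real.rpow_le_one (by norm_num) (by norm_num) hβ0.le
  have hA0 : 0 < A := by rw [hA]; positivity
  have hργ : ρ ≤ ρ ^ γ := by
    simpa using Real.rpow_le_rpow_of_exponent_le (by linarith : 1 ≤ ρ) hγ1
  have hR0 : 1 ≤ R := by linarith
  have hDn : D.Nonempty := closure_nonempty_iff.1
    ⟨0, mem_closure_of_coneGauge_nonpos hα hα' hD (mem_ball_self (by linarith)) (by simp [coneGauge])⟩
  have hfar := fun z (hz : z ∈ closure D) => half_le_norm_sub_of_mem_closure hα hα' hR0 hD hz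
  obtain ⟨hhc, hc₀, hh2⟩ := abs_le_of_dipole_splitting hDo hDb hDn hfar hh hfh hfc hfD hf0
  obtain ⟨B, hBan, hBc, hB⟩ := exists_remainder_of_dipole_pole hα hα' hβ hγ ha hA
  have hPn : ∀ w : ℂ, ‖w ^ (γ : ℂ)‖ = ‖w‖ ^ γ := fun w => Complex.norm_cpow_real w γ
  have hPball : ∀ w : ℂ, ‖w‖ ≤ ρ → w ^ (γ : ℂ) ∈ ball 0 R := by
    intro w hw
    rw [mem_ball_zero_iff, hPn]
    exact (Real.rpow_le_rpow (norm_nonneg w) hw hγ0.le).trans_lt hR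
  have hPq : ∀ w : ℂ, 0 ≤ w.re → 0 ≤ coneGauge α (w ^ (γ : ℂ)) := by
    intro w hw
    rcases hw.eq_or_lt with h' | h'
    · exact (coneGauge_cpow_eq_zero hα hα' hγ h'.symm).ge
    · exact (coneGauge_cpow_pos hα hα' hγ h').le
  have hPD : ∀ w : ℂ, 0 ≤ w.re → ‖w‖ ≤ ρ → w ^ (γ : ℂ) ∈ Dᶜ := fun w hw hw' =>
    notMem_of_coneGauge_nonneg hD (hPball w hw') (hPq w hw)
  have hpa : ∀ w : ℂ, 0 ≤ w.re → w + a ≠ 0 := fun w hw h0 => by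
    have := congrArg Complex.re h0
    simp at this; linarith
  set v : ℂ → ℝ := fun w => h (w ^ (γ : ℂ)) + (2 * Real.pi)⁻¹ * (B w).re - c₀ -
    (2 * Real.pi)⁻¹ * (A / (w + a)).re with hv
  have hvharm : HarmonicOnNhd v {w | 0 < w.re ∧ w ∈ ball 0 ρ} := by
    rintro w ⟨hw, hwρ⟩
    rw [mem_ball_zero_iff] at hwρ
    have h1 : HarmonicAt (fun w : ℂ => h (w ^ (γ : ℂ))) w := by
      refine HarmonicAt.comp_analyticAt (g := fun w : ℂ => w ^ (γ : ℂ)) (hh _ ?_)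
        (analyticAt_id.cpow analyticAt_const (Or.inl hw))
      exact notMem_closure_of_coneGauge_pos hD (hPball w hwρ.le) (coneGauge_cpow_pos hα hα' hγ hw)
    have h2 : HarmonicAt (fun w : ℂ => (B w - A / (w + a)).re) w :=
      ((hBan w hw).sub (analyticAt_const.div (analyticAt_id.add analyticAt_const)
        (hpa w hw.le))).harmonicAt_re
    refine (harmonicAt_congr_nhds (Eventually.of_forall fun x => ?_)).1
      ((h1.add (h2.const_smul (c := (2 * Real.pi)⁻¹))).sub
        (harmonicOnNhd_const c₀ (s := univ) w trivial))
    simp only [Pi.sub_apply, Pi.add_apply, Pi.smul_apply, smul_eq_mul, Complex.sub_re, hv]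
    ring
  have hvcont : ContinuousOn v {w | 0 ≤ w.re ∧ w ∈ closedBall 0 ρ} := by
    refine ((ContinuousOn.add ?_ (continuousOn_const.mul ?_)).sub continuousOn_const).sub
      (continuousOn_const.mul ?_)
    · refine hhc.comp (fun w hw => ?_) fun w hw => hPD w hw.1 (mem_closedBall_zero_iff.1 hw.2)
      exact (Complex.continuousAt_cpow_const_of_re_pos (Or.inl hw.1)
        (by simpa using hγ0)).continuousWithinAt
    · exact Complex.continuous_re.comp_continuousOn (hBc.mono fun w hw => hw.1)
    · refine Complex.continuous_re.comp_continuousOn ?_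
      exact continuousOn_const.div (by fun_prop) fun w hw => hpa w hw.1
  have hv0 : ∀ w : ℂ, w.re = 0 → w ∈ closedBall 0 ρ → v w = 0 := by
    intro w hw hwρ
    rw [mem_closedBall_zero_iff] at hwρ
    have hwa : w ≠ a := fun h' => by rw [h', Complex.ofReal_re] at hw; linarith
    have hfr := mem_frontier_of_coneGauge_eq_zero hα hα' hDo hD (hPball w hwρ)
      (coneGauge_cpow_eq_zero hα hα' hγ hw)
    have hne : w ^ (γ : ℂ) ≠ 1 / 2 := fun h' => by
      have := hfar _ (frontier_subset_closure hfr)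
      rw [h', sub_self, norm_zero] at this
      linarith
    have h1 := hfh _ hne
    rw [hfD _ hfr, dipole, hB w hw.ge hwa, Complex.add_re] at h1
    have h2 : (A / (w - a)).re + (A / (w + a)).re = 0 := by
      simp only [Complex.div_re, Complex.normSq_apply, Complex.sub_re, Complex.sub_im,
        Complex.add_re, Complex.add_im, Complex.ofReal_re, Complex.ofReal_im, hw]
      ring
    simp only [hv]
    linear_combination -h1 - (2 * Real.pi)⁻¹ * h2
  have hv1 : ∀ w : ℂ, 0 ≤ w.re → ‖w‖ = ρ → |v w| ≤ 4 + 2 * A := by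
    intro w hw hwρ
    have hwa : w ≠ a := fun h' => by
      rw [h', Complex.norm_real, Real.norm_eq_abs, abs_of_pos ha0] at hwρ
      linarith
    have hBw : (2 * Real.pi)⁻¹ * (B w).re =
        dipole (w ^ (γ : ℂ) - 1 / 2) - (2 * Real.pi)⁻¹ * (A / (w - a)).re := by
      rw [dipole, hB w hw hwa, Complex.add_re]; ring
    have hdip : |dipole (w ^ (γ : ℂ) - 1 / 2)| ≤ 1 := by
      refine abs_dipole_le_one ?_
      have h1 := norm_sub_norm_le (w ^ (γ : ℂ)) (1 / 2)
      have h2 : ‖(1 / 2 : ℂ)‖ = 1 / 2 := by norm_num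
      rw [hPn, hwρ, h2] at h1
      linarith
    have hfrac : ∀ u : ℂ, 1 ≤ ‖u‖ → |(2 * Real.pi)⁻¹ * (A / u).re| ≤ A := by
      intro u hu
      have h1 : (2 * Real.pi)⁻¹ ≤ 1 := inv_le_one_of_one_le₀ (by linarith [Real.pi_gt_three])
      have h2 : ‖(A : ℂ) / u‖ ≤ A := by
        rw [norm_div, Complex.norm_real, Real.norm_eq_abs, abs_of_pos hA0]
        exact div_le_self hA0.le hu
      rw [abs_mul, abs_of_pos (by positivity)]
      calc (2 * Real.pi)⁻¹ * |((A : ℂ) / u).re| ≤ 1 * A := by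
            gcongr; exact (Complex.abs_re_le_norm _).trans h2
        _ = A := one_mul A
    have hna : ‖(a : ℂ)‖ = a := by rw [Complex.norm_real, Real.norm_eq_abs, abs_of_pos ha0]
    have h3 := hfrac (w - a) (by
      have := norm_sub_norm_le w a
      linarith)
    have h4 := hfrac (w + a) (by
      have := norm_sub_norm_le w (-a)
      rw [norm_neg, sub_neg_eq_add] at this
      linarith)
    have h5 := hh2 _ (hPD w hw hwρ.le)
    simp only [hv, hBw]
    rw [abs_le] at *
    constructor <;> linarith [h3.1, h3.2, h4.1, h4.2, h5.1, h5.2, hdip.1, hdip.2, hc₀.1, hc₀.2]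
  obtain ⟨F, hF, hvF, hFd⟩ := HarmonicOnNhd.exists_norm_deriv_le_of_halfDisc (by linarith : 0 < ρ)
    (by positivity) hvharm hvcont hv0 hv1 hζ (by linarith)
  refine ⟨F, hF, hFd, ?_⟩
  filter_upwards [hvF, (isOpen_lt continuous_const Complex.continuous_re).mem_nhds hζ]
    with w hw hwre hwa hne
  rw [← hw, hfh _ hne, dipole, hB w (le_of_lt hwre) hwa, hv]
  simp only [mul_add, Complex.add_re, div_eq_mul_inv]
  ring

open InnerProductSpace in
/-- The gradient estimate at the corner, at unit scale. -/
theorem exists_corner_gradient_bounds {α β γ : ℝ} (hα : 0 < α) (hα' : α < Real.pi)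
    (hβ : β = Real.pi / (2 * Real.pi - α)) (hγ : γ = (2 * Real.pi - α) / Real.pi) :
    ∃ κ, 0 < κ ∧ κ < 1 / 2 ∧ ∃ ρ₀ c C : ℝ, 0 < ρ₀ ∧ 0 < c ∧ 0 < C ∧
      ∀ ρ R : ℝ, ρ₀ ≤ ρ → ρ ^ γ < R → ∀ D : Set ℂ, IsOpen D → Bornology.IsBounded D →
      D ∩ ball 0 R = {z | coneGauge α z < 0} ∩ ball 0 R →
      ∀ (f h : ℂ → ℝ) (c₀ : ℝ), HarmonicOnNhd h (closure D)ᶜ →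
      (∀ z, z ≠ 1 / 2 → f z = h z + dipole (z - 1 / 2)) →
      ContinuousOn f (Dᶜ \ {1 / 2}) → (∀ z ∈ frontier D, f z = c₀) →
      Tendsto f (Bornology.cobounded ℂ) (nhds 0) → ∀ z ∈ ball 0 κ \ closure D,
        ∃ Φ : ℂ → ℂ, DifferentiableAt ℂ Φ z ∧ f =ᶠ[nhds z] (fun w => (Φ w).re) ∧
          c * ‖z‖ ^ (β - 1) ≤ ‖deriv Φ z‖ ∧ ‖deriv Φ z‖ ≤ C * ‖z‖ ^ (β - 1) := by
  have hπ := Real.pi_pos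
  have hd : 0 < 2 * Real.pi - α := by linarith
  have hβ0 : 0 < β := by rw [hβ]; positivity
  have hγ1 : 1 ≤ γ := by rw [hγ, le_div_iff₀ hπ]; linarith
  have hγ0 : 0 < γ := by linarith
  have hβγ : γ * β = 1 := by
    rw [hβ, hγ, div_mul_div_cancel₀ hπ.ne', div_self hd.ne']
  obtain ⟨a, ha⟩ : ∃ a : ℝ, a = (1 / 2 : ℝ) ^ β := ⟨_, rfl⟩
  obtain ⟨A, hA⟩ : ∃ A : ℝ, A = (γ * a ^ (γ - 1))⁻¹ := ⟨_, rfl⟩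
  have ha0 : 0 < a := by rw [ha]; positivity
  have ha1 : a ≤ 1 := by
    rw [ha]; exact Real.rpow_le_one (by norm_num) (by norm_num) hβ0.le
  have hA0 : 0 < A := by rw [hA]; positivity
  set L : ℝ := (2 * Real.pi)⁻¹ * A / a ^ 2 with hL
  have hL0 : 0 < L := by positivity
  set M : ℝ := 16 * Real.exp 2 * (4 + 2 * A) with hM
  have hM0 : 0 < M := by positivity
  have hκγ : (1 / 2 : ℝ) ^ γ ≤ 1 / 2 := by
    have := Real.rpow_le_rpow_of_exponent_ge (by norm_num : (0 : ℝ) < 1 / 2) (by norm_num) hγ1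
    rwa [Real.rpow_one] at this
  have hκ0 : (0 : ℝ) < (1 / 2) ^ γ := by positivity
  refine ⟨1 / 2 * (1 / 2) ^ γ, by positivity, by linarith, max 2 (4 * M / L), β * (L / 4),
    β * (9 * L), by positivity, by positivity, by positivity, ?_⟩
  intro ρ R hρ hR D hDo hDb hD f h c₀ hh hfh hfc hfD hf0 z hz
  have hρ2 : 2 ≤ ρ := (le_max_left _ _).trans hρ
  have hργ : ρ ≤ ρ ^ γ := by
    simpa using Real.rpow_le_rpow_of_exponent_le (by linarith : 1 ≤ ρ) hγ1
  have hzn : ‖z‖ < 1 / 2 * (1 / 2) ^ γ := mem_ball_zero_iff.1 hz.1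
  have hzR : z ∈ ball 0 R := by rw [mem_ball_zero_iff]; linarith
  have hq : 0 < coneGauge α z := by
    by_contra! hle
    exact hz.2 (mem_closure_of_coneGauge_nonpos hα hα' hD hzR hle)
  obtain ⟨hre, -, hslit⟩ := cpow_of_coneGauge_pos hα hα' hβ hγ hq
  set ζ : ℂ := z ^ (β : ℂ) with hζ
  have hz0 : z ≠ 0 := fun h' => by simp [h', coneGauge] at hq
  have hζn : ‖ζ‖ < a / 2 := by
    rw [hζ, Complex.norm_cpow_real]
    calc ‖z‖ ^ β < (1 / 2 * (1 / 2) ^ γ) ^ β := Real.rpow_lt_rpow (norm_nonneg z) hzn hβ0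
      _ = a / 2 := by
        rw [Real.mul_rpow (by norm_num) hκ0.le, ← Real.rpow_mul (by norm_num), hβγ, ha,
          Real.rpow_one]
        ring
  obtain ⟨F, hF, hFd, hFf⟩ := exists_flattened_remainder hα hα' hβ hγ ha hA hρ2 hR hDo hDb hD hh
    hfh hfc hfD hf0 hre (by linarith)
  have hpow : HasDerivAt (fun w : ℂ => w ^ (β : ℂ)) (β * z ^ ((β : ℂ) - 1)) z := by
    simpa using (hasDerivAt_id' z).cpow_const (c := (β : ℂ)) hslit
  have hζa : ‖ζ‖ < ‖(a : ℂ)‖ := by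
    rw [Complex.norm_real, Real.norm_eq_abs, abs_of_pos ha0]; linarith
  have hp : ζ + a ≠ 0 := fun h' => by
    rw [eq_neg_of_add_eq_zero_left h', norm_neg] at hζa; exact lt_irrefl _ hζa
  have hm : ζ - a ≠ 0 := fun h' => by
    rw [sub_eq_zero.1 h'] at hζa; exact lt_irrefl _ hζa
  set G : ℂ → ℂ := fun w => F w + c₀ + ((2 * Real.pi : ℝ) : ℂ)⁻¹ * (A * ((w + a)⁻¹ + (w - a)⁻¹)) with hG
  set T : ℂ := ((2 * Real.pi : ℝ) : ℂ)⁻¹ * (A * (-((ζ + a) ^ 2)⁻¹ + -((ζ - a) ^ 2)⁻¹)) with hT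
  have hGd : HasDerivAt G (deriv F ζ + T) ζ := by
    have h1 := (((hasDerivAt_id' ζ).add_const (a : ℂ)).fun_inv hp).fun_add
      (((hasDerivAt_id' ζ).sub_const (a : ℂ)).fun_inv hm)
    have h2 := (hF.differentiableAt.hasDerivAt.add_const (c₀ : ℂ)).fun_add
      ((h1.const_mul (A : ℂ)).const_mul (((2 * Real.pi : ℝ) : ℂ)⁻¹))
    refine h2.congr_deriv ?_
    simp only [neg_div, one_div, hT]
  have hΦ : HasDerivAt (fun w => G (w ^ (β : ℂ))) ((deriv F ζ + T) * (β * z ^ ((β : ℂ) - 1))) z :=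
    HasDerivAt.comp (h₂ := G) z hGd hpow
  refine ⟨fun w => G (w ^ (β : ℂ)), hΦ.differentiableAt, ?_, ?_⟩
  · have hcont : Tendsto (fun w : ℂ => w ^ (β : ℂ)) (nhds z) (nhds ζ) := hpow.continuousAt
    have hne : z ≠ 1 / 2 := fun h' => by
      rw [h'] at hzn; norm_num at hzn; linarith
    filter_upwards [hcont.eventually hFf, hcont.eventually (isOpen_ne.mem_nhds (sub_ne_zero.1 hm)),
      (isOpen_lt continuous_const (continuous_coneGauge α)).mem_nhds hq, isOpen_ne.mem_nhds hne]
      with w h1 h2 h3 h4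
    have h5 := (cpow_of_coneGauge_pos hα hα' hβ hγ h3).2.1
    rw [h5] at h1
    rw [h1 h2 h4, hG]
    simp only [Complex.add_re, Complex.ofReal_re]
    simp only [← Complex.ofReal_inv, Complex.re_ofReal_mul]
  · rw [hΦ.deriv, norm_mul, norm_mul]
    have hzβ : ‖z ^ ((β : ℂ) - 1)‖ = ‖z‖ ^ (β - 1) := by
      rw [← Complex.norm_cpow_real]; push_cast; rfl
    rw [hzβ, Complex.norm_real, Real.norm_eq_abs, abs_of_pos hβ0]
    obtain ⟨hlow, hup⟩ := norm_inv_sq_add_inv_sq_bounds ha0 hζn.le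
    have hmain : ‖T‖ =
        (2 * Real.pi)⁻¹ * A * ‖((ζ + a) ^ 2)⁻¹ + ((ζ - a) ^ 2)⁻¹‖ := by
      rw [hT, ← neg_add, norm_mul, norm_mul, norm_neg, norm_inv, Complex.norm_real, Complex.norm_real,
        Real.norm_eq_abs, Real.norm_eq_abs, abs_of_pos hA0, abs_of_pos (by positivity), mul_assoc]
    have hpos : 0 < (2 * Real.pi)⁻¹ * A := by positivity
    have hlow' : L / 2 ≤ (2 * Real.pi)⁻¹ * A * ‖((ζ + a) ^ 2)⁻¹ + ((ζ - a) ^ 2)⁻¹‖ := by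
      refine le_trans (le_of_eq ?_) (mul_le_mul_of_nonneg_left hlow hpos.le)
      rw [hL]; field_simp
    have hup' : (2 * Real.pi)⁻¹ * A * ‖((ζ + a) ^ 2)⁻¹ + ((ζ - a) ^ 2)⁻¹‖ ≤ 8 * L := by
      refine (mul_le_mul_of_nonneg_left hup hpos.le).trans (le_of_eq ?_)
      rw [hL]; field_simp
    rw [← hmain] at hlow' hup'
    have hFs : ‖deriv F ζ‖ ≤ L / 4 := by
      refine hFd.trans ?_
      rw [div_le_iff₀ (by linarith)]
      have := (le_max_right _ _).trans hρ
      rw [div_le_iff₀ hL0] at this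
      linarith
    have h6 : L / 4 ≤ ‖deriv F ζ + T‖ := by
      have := norm_sub_norm_le T (-deriv F ζ)
      rw [norm_neg, sub_neg_eq_add, add_comm T] at this
      linarith
    have h7 : ‖deriv F ζ + T‖ ≤ 9 * L := by
      have := norm_add_le (deriv F ζ) T
      linarith
    have hzp : 0 ≤ ‖z‖ ^ (β - 1) := by positivity
    constructor
    · calc β * (L / 4) * ‖z‖ ^ (β - 1) = L / 4 * (β * ‖z‖ ^ (β - 1)) := by ring
        _ ≤ _ := by gcongr
    · calc _ ≤ 9 * L * (β * ‖z‖ ^ (β - 1)) := by gcongr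
        _ = β * (9 * L) * ‖z‖ ^ (β - 1) := by ring

/-- The standard isometry between the complex plane and the Euclidean plane. -/
noncomputable def complexToPlane : ℂ ≃ₗᵢ[ℝ] Plane := Complex.orthonormalBasisOneI.repr

theorem complexToPlane_apply (z : ℂ) : complexToPlane z = !₂[z.re, z.im] := by
  ext i
  fin_cases i <;> simp [complexToPlane]

theorem complexToPlane_symm_e₁ : complexToPlane.symm !₂[1, 0] = 1 := by
  rw [LinearIsometryEquiv.symm_apply_eq, complexToPlane_apply]
  simp

theorem laplacian_comp_complexToPlane_symm {ψ : ℂ → ℝ} (z : ℂ) :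
    Δ (ψ ∘ complexToPlane.symm) (complexToPlane z) = Δ ψ z := by
  rw [InnerProductSpace.laplacian_eq_iteratedFDeriv_orthonormalBasis _
    (Complex.orthonormalBasisOneI.map complexToPlane),
    InnerProductSpace.laplacian_eq_iteratedFDeriv_orthonormalBasis _ Complex.orthonormalBasisOneI]
  refine Finset.sum_congr rfl fun i _ => ?_
  have h := complexToPlane.symm.toContinuousLinearEquiv.iteratedFDerivWithin_comp_right ψ
    uniqueDiffOn_univ (mem_univ (complexToPlane.symm (complexToPlane z))) 2
  simp only [LinearIsometryEquiv.coe_toContinuousLinearEquiv, preimage_univ,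
    iteratedFDerivWithin_univ] at h
  rw [h, ContinuousMultilinearMap.compContinuousLinearMap_apply,
    LinearIsometryEquiv.symm_apply_apply]
  congr 1
  ext j
  fin_cases j <;> simp

open InnerProductSpace in
/-- A distributional solution of the dipole equation in the plane is, in complex coordinates, the
sum of the free dipole and a harmonic function. -/
theorem LaplaceEqDipole.exists_harmonicOnNhd {u : Plane → ℝ} {U : Set Plane} (hU : IsOpen U)
    (hu : LaplaceEqDipole u U !₂[1, 0] 0) (hc : ContinuousOn u (U \ {0})) :
    ∃ h : ℂ → ℝ, HarmonicOnNhd h (complexToPlane ⁻¹' U) ∧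
      ∀ z, z ≠ 0 → u (complexToPlane z) = h z + dipole z := by
  have hmp : MeasurePreserving complexToPlane volume volume := complexToPlane.measurePreserving
  have hme : MeasurableEmbedding complexToPlane :=
    complexToPlane.toHomeomorph.measurableEmbedding
  refine exists_harmonicOnNhd_add_dipole (f := fun z => u (complexToPlane z))
    (hU.preimage complexToPlane.continuous) ?_ ?_ ?_
  · intro z hz
    obtain ⟨t, ht, hti⟩ := hu.1 (complexToPlane z) hz
    refine ⟨complexToPlane ⁻¹' t, ?_, (hmp.integrableOn_comp_preimage hme).2 hti⟩
    exact (complexToPlane.continuous.continuousWithinAt.tendsto_nhdsWithin fun w hw => hw) ht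
  · refine hc.comp complexToPlane.continuous.continuousOn fun z hz => ⟨hz.1, fun h0 => hz.2 ?_⟩
    simpa using h0
  · intro ψ hψ hs hsub
    have h1 := hu.2 (ψ ∘ complexToPlane.symm)
      (hψ.comp complexToPlane.symm.toContinuousLinearEquiv.contDiff)
      (hs.comp_homeomorph complexToPlane.symm.toHomeomorph)
      (by
        have h0 : tsupport (ψ ∘ complexToPlane.symm) ⊆ complexToPlane.symm ⁻¹' tsupport ψ :=
          closure_minimal (fun x hx => subset_tsupport ψ hx)
            ((isClosed_tsupport ψ).preimage complexToPlane.symm.continuous)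
        intro x hx
        have := hsub (h0 hx)
        rwa [mem_preimage, LinearIsometryEquiv.apply_symm_apply] at this)
    have h2 : fderiv ℝ (ψ ∘ complexToPlane.symm) 0 !₂[1, 0] = fderiv ℝ ψ 0 1 := by
      have hd : HasFDerivAt ψ (fderiv ℝ ψ 0) (complexToPlane.symm 0) := by
        rw [map_zero]; exact (hψ.differentiable (by simp) 0).hasFDerivAt
      rw [(hd.comp (0 : Plane)
        complexToPlane.symm.toContinuousLinearEquiv.hasFDerivAt).fderiv]
      simp [complexToPlane_symm_e₁]
    rw [h2, ← hmp.integral_comp hme] at h1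
    simpa only [laplacian_comp_complexToPlane_symm] using h1

/-- The differential of the real part of a holomorphic function. -/
theorem hasFDerivAt_re_of_hasDerivAt {Φ : ℂ → ℂ} {z a : ℂ} (h : HasDerivAt Φ a z) :
    HasFDerivAt (fun w => (Φ w).re) (innerSL ℝ ((starRingEnd ℂ) a)) z := by
  have h1 := Complex.reCLM.hasFDerivAt.comp z (h.hasFDerivAt.restrictScalars ℝ)
  refine h1.congr_fderiv ?_
  ext w
  simp only [innerSL_apply_apply, Complex.inner, Complex.conj_conj]
  simp [mul_comm]

/-- The change of coordinates which sends the unit scale to the scale `ε` and the origin to the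
vertex. -/
noncomputable def scaledCoordinates {ε : ℝ} (hε : ε ≠ 0) : ℂ ≃ₜ Plane :=
  ((Homeomorph.smulOfNeZero ε hε).trans complexToPlane.toHomeomorph).trans
    (Homeomorph.addLeft (vertex ε))

theorem scaledCoordinates_apply {ε : ℝ} (hε : ε ≠ 0) (z : ℂ) :
    scaledCoordinates hε z = vertex ε + complexToPlane (ε • z) := rfl

theorem scaledCoordinates_symm_apply {ε : ℝ} (hε : ε ≠ 0) (X : Plane) :
    (scaledCoordinates hε).symm X = ε⁻¹ • complexToPlane.symm (X - vertex ε) := by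
  rw [Homeomorph.symm_apply_eq, scaledCoordinates_apply, smul_smul, mul_inv_cancel₀ hε, one_smul,
    LinearIsometryEquiv.apply_symm_apply, add_sub_cancel]

theorem scaledCoordinates_eq {ε : ℝ} (hε : ε ≠ 0) (z : ℂ) :
    scaledCoordinates hε z = complexToPlane (ε * (z - 1 / 2)) := by
  have : vertex ε = complexToPlane ((-ε / 2 : ℝ) : ℂ) := by
    rw [complexToPlane_apply, vertex]; simp
  rw [scaledCoordinates_apply, this, ← map_add, Complex.real_smul]
  congr 1
  push_cast
  ring

theorem mem_preimage_scaledCoordinates {ε : ℝ} (hε : ε ≠ 0) (D : Set Plane) (z : ℂ) :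
    z ∈ scaledCoordinates hε ⁻¹' cornerInclusion D ε ↔ complexToPlane (ε • z) ∈ D := by
  rw [mem_preimage, scaledCoordinates_apply, cornerInclusion, mem_vadd_set_iff_neg_vadd_mem,
    vadd_eq_add, neg_add_cancel_left]

theorem preimage_scaledCoordinates_inter_ball {α μ ε : ℝ} (hε : 0 < ε) {D : Set Plane}
    (hD : D ∩ ball 0 μ = leftCone α ∩ ball 0 μ) :
    scaledCoordinates hε.ne' ⁻¹' cornerInclusion D ε ∩ ball 0 (μ / ε) =
      {z | coneGauge α z < 0} ∩ ball 0 (μ / ε) := by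
  ext z
  have hball : z ∈ ball 0 (μ / ε) ↔ complexToPlane (ε • z) ∈ ball (0 : Plane) μ := by
    rw [mem_ball_zero_iff, mem_ball_zero_iff, LinearIsometryEquiv.norm_map, norm_smul,
      Real.norm_eq_abs, abs_of_pos hε, lt_div_iff₀ hε, mul_comm]
  have hcone : complexToPlane (ε • z) ∈ leftCone α ↔ coneGauge α z < 0 := by
    rw [complexToPlane_apply, leftCone, coneGauge, mem_ofPred_eq]
    simp only [Complex.real_smul, Complex.re_ofReal_mul, Complex.im_ofReal_mul]
    simp only [Matrix.cons_val_zero, Matrix.cons_val_one]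
    rw [abs_mul, abs_of_pos hε]
    constructor
    · intro h
      by_contra! hn
      nlinarith
    · intro h
      nlinarith
  rw [mem_inter_iff, mem_inter_iff, mem_preimage_scaledCoordinates, hball, ← mem_inter_iff, hD,
    mem_inter_iff, hcone, mem_ofPred_eq]

theorem dipole_real_mul {ε : ℝ} (hε : ε ≠ 0) (z : ℂ) : ε * dipole (ε * z) = dipole z := by
  rw [dipole, dipole, _root_.mul_inv (ε : ℂ), ← Complex.ofReal_inv, Complex.re_ofReal_mul]
  field_simp

theorem theorem4p10 (α μ : ℝ) (hα : 0 < α) (hα' : α < Real.pi) (hμ : 1 < μ)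
    (D : Set Plane) (hD : IsCornerShape α μ D) (β : ℝ)
    (hβ : β = Real.pi / (2 * Real.pi - α)) :
    ∃ κ₀ : ℝ, 0 < κ₀ ∧ κ₀ < 1 / 2 ∧ ∃ ε₀ : ℝ, 0 < ε₀ ∧ ∃ c C : ℝ, 0 < c ∧ 0 < C ∧
      ∀ ε : ℝ, 0 < ε → ε ≤ ε₀ →
        ∀ u : Plane → ℝ, IsDipoleSolution (cornerInclusion D ε) u →
          ∀ X ∈ ball (vertex ε) (κ₀ * ε) \ closure (cornerInclusion D ε),
            DifferentiableAt ℝ u X ∧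
            c * (ε ^ (-1 - β) * ‖X - vertex ε‖ ^ (β - 1)) ≤ ‖gradient u X‖ ∧
            ‖gradient u X‖ ≤ C * (ε ^ (-1 - β) * ‖X - vertex ε‖ ^ (β - 1)) := by
  have hπ := Real.pi_pos
  have hd : 0 < 2 * Real.pi - α := by linarith
  obtain ⟨γ, hγ⟩ : ∃ γ, γ = (2 * Real.pi - α) / Real.pi := ⟨_, rfl⟩
  have hβ0 : 0 < β := by rw [hβ]; positivity
  have hβγ : γ * β = 1 := by
    rw [hβ, hγ, div_mul_div_cancel₀ hπ.ne', div_self hd.ne']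
  obtain ⟨κ, hκ, hκ2, ρ₀, c, C, hρ₀, hc, hC, key⟩ := exists_corner_gradient_bounds hα hα' hβ hγ
  refine ⟨κ, hκ, hκ2, (ρ₀ ^ γ)⁻¹, by positivity, c, C, hc, hC, ?_⟩
  intro ε hε hε₀ u hu X hX
  set S := scaledCoordinates hε.ne' with hS
  set Ω := cornerInclusion D ε with hΩ
  have hΩo : IsOpen Ω := hD.isOpen.vadd (vertex ε)
  have hDo : IsOpen (S ⁻¹' Ω) := hΩo.preimage S.continuous
  have hDb : Bornology.IsBounded (S ⁻¹' Ω) := by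
    obtain ⟨r, hr⟩ := hD.isBounded.subset_closedBall 0
    refine (isBounded_closedBall (x := (0 : ℂ)) (r := r / ε)).subset fun z hz => ?_
    have h1 := hr ((mem_preimage_scaledCoordinates hε.ne' D z).1 hz)
    rw [mem_closedBall_zero_iff, LinearIsometryEquiv.norm_map, norm_smul, Real.norm_eq_abs,
      abs_of_pos hε] at h1
    rw [mem_closedBall_zero_iff, le_div_iff₀ hε, mul_comm]
    exact h1
  obtain ⟨c₀, hc₀⟩ := hu.boundary
  obtain ⟨h, hh, huh⟩ := hu.equation.exists_harmonicOnNhd isClosed_closure.isOpen_compl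
    (hu.continuousOn.mono (sdiff_subset_sdiff_left (compl_subset_compl.2 subset_closure)))
  have hSeq : ∀ z, S z = complexToPlane (ε * (z - 1 / 2)) := scaledCoordinates_eq hε.ne'
  have hSlim : Tendsto S (Bornology.cobounded ℂ) (Bornology.cobounded Plane) := by
    rw [← tendsto_norm_atTop_iff_cobounded]
    have h1 : Tendsto (fun z : ℂ => ε * (‖z‖ - 1 / 2)) (Bornology.cobounded ℂ) atTop :=
      (tendsto_atTop_add_const_right _ (-(1 / 2)) tendsto_norm_cobounded_atTop).const_mul_atTop hε
    refine tendsto_atTop_mono (fun z => ?_) h1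
    rw [hSeq, LinearIsometryEquiv.norm_map, norm_mul, Complex.norm_real, Real.norm_eq_abs,
      abs_of_pos hε]
    have h2 := norm_sub_norm_le z (1 / 2)
    have h3 : ‖(1 / 2 : ℂ)‖ = 1 / 2 := by norm_num
    rw [h3] at h2
    gcongr
  have hu0 : Tendsto u (Bornology.cobounded Plane) (nhds 0) :=
    hu.decay.trans_tendsto (tendsto_inv_atTop_zero.comp tendsto_norm_cobounded_atTop)
  have hXn : ‖X - vertex ε‖ = ε * ‖S.symm X‖ := by
    rw [hS, scaledCoordinates_symm_apply, norm_smul, LinearIsometryEquiv.norm_map, norm_inv,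
      Real.norm_eq_abs, abs_of_pos hε, mul_inv_cancel_left₀ hε.ne']
  obtain ⟨Φ, hΦ, hfΦ, hlow, hup⟩ := key ((1 / ε) ^ β) (μ / ε)
    (by
      have h1 : ρ₀ ^ γ ≤ 1 / ε := by
        rw [one_div]; exact (le_inv_comm₀ hε (by positivity)).1 hε₀
      calc ρ₀ = (ρ₀ ^ γ) ^ β := by rw [← Real.rpow_mul hρ₀.le, hβγ, Real.rpow_one]
        _ ≤ (1 / ε) ^ β := Real.rpow_le_rpow (by positivity) h1 hβ0.le)
    (by
      rw [← Real.rpow_mul (by positivity), mul_comm β, hβγ, Real.rpow_one]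
      gcongr)
    (S ⁻¹' Ω) hDo hDb (preimage_scaledCoordinates_inter_ball hε hD.eq_cone)
    (fun z => ε * u (S z)) (fun z => ε * h (ε * (z - 1 / 2))) (ε * c₀)
    (by
      intro z hz
      refine InnerProductSpace.HarmonicAt.const_smul (c := ε) (f := fun z : ℂ => h (ε * (z - 1 / 2))) ?_
      refine HarmonicAt.comp_analyticAt (g := fun z : ℂ => ε * (z - 1 / 2)) (hh _ ?_) (by fun_prop)
      rw [← S.preimage_closure, mem_compl_iff, mem_preimage, hSeq] at hz
      exact hz)
    (by
      intro z hz
      have hne : (ε : ℂ) * (z - 1 / 2) ≠ 0 :=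
        mul_ne_zero (by exact_mod_cast hε.ne') (sub_ne_zero.2 hz)
      rw [hSeq, huh _ hne, mul_add, dipole_real_mul hε.ne'])
    (by
      refine continuousOn_const.mul (hu.continuousOn.comp S.continuous.continuousOn ?_)
      rintro z ⟨hz, hz'⟩
      refine ⟨hz, fun h0 => hz' ?_⟩
      rw [mem_singleton_iff, hSeq, LinearIsometryEquiv.map_eq_zero_iff, mul_eq_zero] at h0
      exact sub_eq_zero.1 (h0.resolve_left (by exact_mod_cast hε.ne')))
    (by
      intro z hz
      rw [← S.preimage_frontier] at hz
      rw [hc₀ _ hz])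
    (by simpa using (hu0.comp hSlim).const_mul ε)
    (S.symm X)
    (by
      refine ⟨?_, ?_⟩
      · have h1 := hX.1
        rw [mem_ball, dist_eq_norm, hXn, mul_comm] at h1
        rw [mem_ball_zero_iff]
        exact lt_of_mul_lt_mul_right h1 hε.le
      · rw [← S.preimage_closure, mem_preimage, S.apply_symm_apply]
        exact hX.2)
  have hSd : HasFDerivAt S.symm
      (ε⁻¹ • (complexToPlane.symm.toContinuousLinearEquiv : Plane →L[ℝ] ℂ)) X := by
    have h1 : (S.symm : Plane → ℂ) = fun X => ε⁻¹ • complexToPlane.symm (X - vertex ε) :=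
      funext (scaledCoordinates_symm_apply hε.ne')
    rw [h1]
    have h2 := (complexToPlane.symm.toContinuousLinearEquiv.hasFDerivAt
      (x := X - vertex ε)).comp X ((hasFDerivAt_id X).sub_const (vertex ε))
    rw [ContinuousLinearMap.comp_id] at h2
    exact h2.const_smul ε⁻¹
  have hfd : HasFDerivAt (fun z => ε * u (S z))
      (innerSL ℝ ((starRingEnd ℂ) (deriv Φ (S.symm X)))) (S.symm X) :=
    (hasFDerivAt_re_of_hasDerivAt hΦ.hasDerivAt).congr_of_eventuallyEq hfΦ
  have hud := (hfd.comp X hSd).const_smul ε⁻¹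
  have hueq : (ε⁻¹ • ((fun z => ε * u (S z)) ∘ S.symm)) = u := by
    ext Y
    simp [inv_mul_cancel_left₀ hε.ne']
  rw [hueq] at hud
  have hnorm : ‖gradient u X‖ = ε⁻¹ ^ 2 * ‖deriv Φ (S.symm X)‖ := by
    rw [gradient, LinearIsometryEquiv.norm_map, hud.fderiv, ContinuousLinearMap.comp_smul,
      smul_smul, norm_smul]
    have h1 := ContinuousLinearMap.opNorm_comp_linearIsometryEquiv
      (innerSL ℝ ((starRingEnd ℂ) (deriv Φ (S.symm X)))) complexToPlane.symm
    have h2 : ‖innerSL ℝ ((starRingEnd ℂ) (deriv Φ (S.symm X)))‖ = ‖deriv Φ (S.symm X)‖ := by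
      rw [innerSL_apply_norm, RCLike.norm_conj]
    rw [h2] at h1
    rw [Real.norm_eq_abs, abs_of_pos (by positivity), pow_two]
    congr 1
  have hscale : ε ^ (-1 - β) * ‖X - vertex ε‖ ^ (β - 1) =
      ε⁻¹ ^ 2 * ‖S.symm X‖ ^ (β - 1) := by
    rw [hXn, Real.mul_rpow hε.le (norm_nonneg _), ← mul_assoc, ← Real.rpow_add hε]
    congr 1
    rw [show -1 - β + (β - 1) = -(2 : ℕ) by push_cast; ring, Real.rpow_neg hε.le,
      Real.rpow_natCast, inv_pow]
  refine ⟨hud.differentiableAt, ?_, ?_⟩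
  · rw [hnorm, hscale]
    calc c * (ε⁻¹ ^ 2 * ‖S.symm X‖ ^ (β - 1)) = ε⁻¹ ^ 2 * (c * ‖S.symm X‖ ^ (β - 1)) := by ring
      _ ≤ _ := by gcongr
  · rw [hnorm, hscale]
    calc _ ≤ ε⁻¹ ^ 2 * (C * ‖S.symm X‖ ^ (β - 1)) := by gcongr
      _ = C * (ε⁻¹ ^ 2 * ‖S.symm X‖ ^ (β - 1)) := by ring
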